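/- **Setting.** Structured matrices have entries in $\{0,*\}$. A real matrix is a numerical realization of a structured matrix if it vanishes wherever the structured matrix has a $0$. A structured pair $(\bar A,\bar B)$ is structurally controllable if some numerical realization $(A,B)$ is controllable, that is, $[B, AB,\dots,A^{N-1}B]$ has rank $N$, where $N$ is the number of states. Take $k$ subsystems $S_1,\dots,S_k$, each with states $x^i_1,\dots,x^i_{n_s}$ and the same structured state matrix $\bar A_s\in\{0,*\}^{n_s\times n_s}$, and a single structured input $\bar B\in\{0,*\}^{kn_s\times 1}$ with input node $u_1$. Let $\mathcal K$ be the set of all $\bar A'\in\{0,*\}^{kn_s\times kn_s}$ whose $k$ diagonal $n_s\times n_s$ blocks all equal $\bar A_s$ and for which $(\bar A',\bar B)$ is structurally controllable. The $*$ entries of $\bar A'$ in off-diagonal blocks are its interconnections. An optimal solution is an $\bar A^*\in\mathcal K$ with the fewest $*$ entries (equivalently, with the fewest interconnections); let $|\mathcal I^*|$ be its number of interconnections. **The number $q$.** The digraph $\mathcal D_i(\bar A_s)$ of the $i$-th subsystem has the edge $x^i_p\to x^i_r$ iff $(\bar A_s)_{rp}=*$. A strongly connected component (SCC) of it is non-top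 linked if no edge enters it from outside it. Let $\mathcal N$ be the set of all non-top linked SCCs of $\mathcal D_1(\bar A_s),\dots,\mathcal D_k(\bar A_s)$ that cannot be reached by a directed path from $u_1$ when there are no interconnections, i.e. in the digraph whose edges are those of all the $\mathcal D_i(\bar A_s)$ together with $u_1\to x^i_p$ whenever $\bar B$ has a $*$ in the row of $x^i_p$. Put $q=|\mathcal N|$. **The matching.** The bipartite graph $\mathcal B(\bar A,\bar B,\mathcal N)$ has left nodes $x'^i_p$, one for each state, and as right nodes all states $x^j_r$, the input $u_1$, and one node for each element of $\mathcal N$. Its edges and their costs are: - $(x'^i_p,u_1)$ whenever $u_1\to x^i_p$: cost $0$; - $(x'^i_p,x^i_r)$ whenever $(\bar A_s)_{pr}=*$: cost $1$; - $(x'^i_p,\mathcal N_j)$ whenever $x^i_p\in\mathcal N_j$: cost $2$; - $(x'^i_p,x^j_r)$ for all $i\ne j$ and all $p,r$ (interconnection edges): cost $3$. A perfect matching is a matching whose size is the minimum of the numbers of left and right nodes. Let $M^*$ be a perfect matching of minimum total cost, and let $\beta_{\mathcal I}$ be its number of interconnection edges. **Theorem.** If $\bar A^*$ is any optimal solution and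 $M^*$ is any minimum-cost perfect matching of $\mathcal B(\bar A,\bar B,\mathcal N)$, then $$|\mathcal I^*|=\beta_{\mathcal I}+q.$$ Moreover, if $k\ge 2$ and $\bar B$ has at least one $*$ entry, then an optimal solution $\bar A^*$ and a minimum-cost perfect matching $M^*$ exist. -/

import Mathlib

namespace StructuralControl

/-! ## Structured systems and structural controllability -/

/-- A structured matrix with entries in `{0, *}`: `true` stands for `*`, `false` for `0`. -/
abbrev Pattern (ι κ : Type*) : Type _ := Matrix ι κ Bool

/-- `M` is a numerical realization of the structured matrix `P`: it vanishes at every fixed zero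
of `P`, and its remaining entries are free. -/
def IsRealization {ι κ : Type*} (P : Pattern ι κ) (M : Matrix ι κ ℝ) : Prop :=
  ∀ i j, P i j = false → M i j = 0

/-- The controllability matrix `[B, A B, …, A ^ (N - 1) B]`, where `N` is the number of states. -/
def controllabilityMatrix {ι κ : Type*} [Fintype ι] [DecidableEq ι]
    (A : Matrix ι ι ℝ) (B : Matrix ι κ ℝ) : Matrix ι (Fin (Fintype.card ι) × κ) ℝ :=
  Matrix.of fun i c => (A ^ (c.1 : ℕ) * B) i c.2

/-- The pair `(A, B)` is controllable: its controllability matrix has full row rank. -/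
def IsControllable {ι κ : Type*} [Fintype ι] [DecidableEq ι] [Fintype κ]
    (A : Matrix ι ι ℝ) (B : Matrix ι κ ℝ) : Prop :=
  (controllabilityMatrix A B).rank = Fintype.card ι

/-- The structured pair `(P, Q)` has at least one controllable numerical realization. -/
def IsStructurallyControllable {ι κ : Type*} [Fintype ι] [DecidableEq ι] [Fintype κ]
    (P : Pattern ι ι) (Q : Pattern ι κ) : Prop :=
  ∃ (A : Matrix ι ι ℝ) (B : Matrix ι κ ℝ),
    IsRealization P A ∧ IsRealization Q B ∧ IsControllable A B

/-! ## Digraphs, strongly connected components, accessibility -/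

/-- The state digraph: there is an edge `i → j` iff the entry `(j, i)` of `P` is `*`. -/
def stateDigraph {ι : Type*} (P : Pattern ι ι) : Digraph ι where
  Adj i j := P j i = true

/-- The system digraph on states (`Sum.inl`) and inputs (`Sum.inr`). No edge enters an input. -/
def systemDigraph {ι κ : Type*} (P : Pattern ι ι) (Q : Pattern ι κ) : Digraph (ι ⊕ κ) where
  Adj
    | Sum.inl i, Sum.inl j => P j i = true
    | Sum.inr u, Sum.inl j => Q j u = true
    | _, Sum.inr _ => False

/-- There is a directed path (possibly of length zero) from `v` to `w`. -/
def Reaches {V : Type*} (G : Digraph V) (v w : V) : Prop :=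
  Relation.ReflTransGen G.Adj v w

/-- `S` is the vertex set of a strongly connected component of `G`: a class of mutually
reachable vertices. -/
def IsSCC {V : Type*} (G : Digraph V) (S : Set V) : Prop :=
  ∃ v, S = {w | Reaches G v w ∧ Reaches G w v}

/-- No edge of `G` enters `S` from outside `S`. -/
def IsNonTopLinked {V : Type*} (G : Digraph V) (S : Set V) : Prop :=
  ∀ v, v ∉ S → ∀ w, w ∈ S → ¬ G.Adj v w

/-- A state is accessible if some input reaches it in the system digraph. -/
def IsAccessible {ι κ : Type*} (P : Pattern ι ι) (Q : Pattern ι κ) (i : ι) : Prop :=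
  ∃ u : κ, Reaches (systemDigraph P Q) (Sum.inr u) (Sum.inl i)

/-! ## Composition of `k` structurally identical subsystems with `n` states each

The state `(i, p)` is the `p`-th state of the `i`-th subsystem. -/

/-- `P` is a structured state matrix of a composite system: all its diagonal blocks are `As`, and
its off-diagonal blocks are arbitrary. -/
def IsComposite {k n : ℕ} (As : Pattern (Fin n) (Fin n))
    (P : Pattern (Fin k × Fin n) (Fin k × Fin n)) : Prop :=
  ∀ i p q, P (i, p) (i, q) = As p q

/-- The state matrix of the subsystems without any interconnection. -/
def isolatedPattern (k : ℕ) {n : ℕ} (As : Pattern (Fin n) (Fin n)) :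
    Pattern (Fin k × Fin n) (Fin k × Fin n) :=
  Matrix.of fun x y => if x.1 = y.1 then As x.2 y.2 else false

/-- The state matrix of the subsystems composed with all possible interconnections. -/
def fullPattern (k : ℕ) {n : ℕ} (As : Pattern (Fin n) (Fin n)) :
    Pattern (Fin k × Fin n) (Fin k × Fin n) :=
  Matrix.of fun x y => if x.1 = y.1 then As x.2 y.2 else true

/-- The number of `*` entries of a structured matrix. -/
def numStars {ι κ : Type*} [Fintype ι] [Fintype κ] (P : Pattern ι κ) : ℕ :=
  (Finset.univ.filter fun e : ι × κ => P e.1 e.2 = true).card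

/-- The number of interconnections: `*` entries joining two distinct subsystems. -/
def numInterconnections {k n : ℕ} (P : Pattern (Fin k × Fin n) (Fin k × Fin n)) : ℕ :=
  (Finset.univ.filter fun e : (Fin k × Fin n) × (Fin k × Fin n) =>
    e.1.1 ≠ e.2.1 ∧ P e.1 e.2 = true).card

/-- The structurally controllable composite systems for given `As` and input matrix `Q`. -/
def controllableComposites {k n : ℕ} {κ : Type*} [Fintype κ] (As : Pattern (Fin n) (Fin n))
    (Q : Pattern (Fin k × Fin n) κ) : Set (Pattern (Fin k × Fin n) (Fin k × Fin n)) :=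
  {P | IsComposite As P ∧ IsStructurallyControllable P Q}

/-- `P` is an optimal solution: a sparsest structurally controllable composite system. -/
def IsOptimalComposite {k n : ℕ} {κ : Type*} [Fintype κ] (As : Pattern (Fin n) (Fin n))
    (Q : Pattern (Fin k × Fin n) κ) (P : Pattern (Fin k × Fin n) (Fin k × Fin n)) : Prop :=
  P ∈ controllableComposites As Q ∧ ∀ P' ∈ controllableComposites As Q, numStars P ≤ numStars P'

/-- The non-top linked SCCs of the subsystems (as sets of states of the composite system) that are
not accessible when there are no interconnections. -/
def inaccessibleSCCs {k n : ℕ} {κ : Type*} (As : Pattern (Fin n) (Fin n))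
    (Q : Pattern (Fin k × Fin n) κ) : Set (Set (Fin k × Fin n)) :=
  {S | ∃ (i : Fin k) (T : Set (Fin n)), IsSCC (stateDigraph As) T ∧
    IsNonTopLinked (stateDigraph As) T ∧ S = (fun p => (i, p)) '' T ∧
    ∀ x ∈ S, ¬ IsAccessible (isolatedPattern k As) Q x}

/-! ## Bipartite graphs and minimum cost perfect matchings -/

/-- `M` is a matching of the bipartite graph with edge relation `E` between `L` and `R`. -/
def IsMatching {L R : Type*} (E : L → R → Prop) (M : Finset (L × R)) : Prop :=
  (∀ e ∈ M, E e.1 e.2) ∧ ∀ e ∈ M, ∀ f ∈ M, e ≠ f → e.1 ≠ f.1 ∧ e.2 ≠ f.2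

/-- A perfect matching is a matching with `min |L| |R|` edges. -/
def IsPerfectMatching {L R : Type*} (E : L → R → Prop) (M : Finset (L × R)) : Prop :=
  IsMatching E M ∧ M.card = min (Nat.card L) (Nat.card R)

/-- `M` is a perfect matching of minimum total cost. -/
def IsMinCostPerfectMatching {L R : Type*} (E : L → R → Prop) (c : L × R → ℕ)
    (M : Finset (L × R)) : Prop :=
  IsPerfectMatching E M ∧
    ∀ M' : Finset (L × R), IsPerfectMatching E M' → ∑ e ∈ M, c e ≤ ∑ e ∈ M', c e

/-- The right side of the augmented bipartite graph: states, inputs, and one node for each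
inaccessible non-top linked SCC. The left side is a copy of the set of states. -/
abbrev AugRight {k n : ℕ} {κ : Type*} (As : Pattern (Fin n) (Fin n))
    (Q : Pattern (Fin k × Fin n) κ) : Type _ :=
  (Fin k × Fin n) ⊕ (κ ⊕ inaccessibleSCCs As Q)

/-- The edges of the augmented bipartite graph: a left state `x` is joined to a state `y` iff
`y → x` is an edge inside a subsystem or any possible interconnection, to an input `u` iff `u → x`
is an edge, and to an SCC node iff `x` belongs to that SCC. -/
def augEdge {k n : ℕ} {κ : Type*} (As : Pattern (Fin n) (Fin n))
    (Q : Pattern (Fin k × Fin n) κ) : Fin k × Fin n → AugRight As Q → Prop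
  | x, Sum.inl y => fullPattern k As x y = true
  | x, Sum.inr (Sum.inl u) => Q x u = true
  | x, Sum.inr (Sum.inr S) => x ∈ S.1

/-- The cost of an edge: `1` inside a subsystem, `3` for an interconnection, `0` for an edge to an
input, `2` for an edge to an SCC node. -/
def augCost {k n : ℕ} {κ : Type*} (As : Pattern (Fin n) (Fin n))
    (Q : Pattern (Fin k × Fin n) κ) : (Fin k × Fin n) × AugRight As Q → ℕ
  | (x, Sum.inl y) => if x.1 = y.1 then 1 else 3
  | (_, Sum.inr (Sum.inl _)) => 0
  | (_, Sum.inr (Sum.inr _)) => 2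

/-- The test whether an edge of the augmented bipartite graph is an interconnection. -/
def isInterconnectionEdge {k n : ℕ} {κ : Type*} (As : Pattern (Fin n) (Fin n))
    (Q : Pattern (Fin k × Fin n) κ) : (Fin k × Fin n) × AugRight As Q → Bool
  | (x, Sum.inl y) => decide (x.1 ≠ y.1)
  | (_, Sum.inr _) => false

/-- The number of interconnection edges in `M`. -/
def interconnectionEdgeCount {k n : ℕ} {κ : Type*} (As : Pattern (Fin n) (Fin n))
    (Q : Pattern (Fin k × Fin n) κ) (M : Finset ((Fin k × Fin n) × AugRight As Q)) : ℕ :=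
  (M.filter fun e => isInterconnectionEdge As Q e = true).card

end StructuralControl

namespace StructuralControl

/-! Let `m` be the number of states. Matchings that avoid interconnection edges determine both
sides: if `ν` is their largest size, then `β = m - ν` and the optimum is `m + q - ν`.

An input edge, an edge inside a subsystem and an edge to an SCC node get weights 3, 2, 1, that is, 3
minus the cost. A perfect matching has `m` edges, so its cost is `3 * m` minus the weight of its
part without interconnections. The weight of an edge depends only on its right node, and
augmentation never uncovers a right node, so a matching of maximum weight also has maximum size.
Hence `β = m - ν`, provided that a matching `G` of maximum weight can be completed by
interconnections to a perfect one.

A single-input pair is structurally controllable iff every state is accessible and the states have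
distinct predecessors. Necessity of the matching is Hall's theorem. Sufficiency builds a realization
over the cycles of a permutation, with the Hautus eigenvector test for controllability. For the
lower bound, a controllable composite has an interconnection for each state matched across
subsystems and one more for each inaccessible SCC containing no such state. Matching each other SCC
node to such a state inside it gives a matching without interconnections of the required size: an
edge to an SCC node stands for an interconnection that serves both accessibility and the matching.

The upper bound links the paths formed by the state edges of `G` into a single path from the input,
using only interconnections. Consecutive paths must therefore lie in different subsystems. As the
subsystems are identical, state edges can be copied from one to another, and maximality of the
weight forces the path starts to be evenly distributed, up to one extra in the subsystem fed by the
input (`IsMaxWeightMatching.card_stateEdges_le`); then the subsystems can be visited in rotation.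
Each SCC that no such link enters receives one extra edge. -/

/-! ### Bipartite matchings: augmentation and path decomposition -/

lemma IsMatching.mono {L R : Type*} {E E' : L → R → Prop} {M N : Finset (L × R)}
    (hM : IsMatching E M) (hN : N ⊆ M) (h : ∀ e ∈ N, E' e.1 e.2) : IsMatching E' N :=
  ⟨h, fun e he f hf => hM.2 e (hN he) f (hN hf)⟩

lemma IsMatching.card_left {L R : Type*} [DecidableEq L] {E : L → R → Prop} {M : Finset (L × R)}
    (hM : IsMatching E M) : (M.image Prod.fst).card = M.card :=
  Finset.card_image_of_injOn fun e he f hf h => by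
    by_contra hne; exact (hM.2 e he f hf hne).1 h

lemma IsMatching.card_right {L R : Type*} [DecidableEq R] {E : L → R → Prop} {M : Finset (L × R)}
    (hM : IsMatching E M) : (M.image Prod.snd).card = M.card :=
  Finset.card_image_of_injOn fun e he f hf h => by
    by_contra hne; exact (hM.2 e he f hf hne).2 h

lemma IsMatching.insert {L R : Type*} [DecidableEq L] [DecidableEq R] {E : L → R → Prop}
    {M : Finset (L × R)} (hM : IsMatching E M) {x : L} {y : R} (hxy : E x y)
    (hx : ∀ e ∈ M, e.1 ≠ x) (hy : ∀ e ∈ M, e.2 ≠ y) : IsMatching E (insert (x, y) M) := by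
  refine ⟨fun e he => ?_, fun e he f hf hef => ?_⟩
  · rcases Finset.mem_insert.1 he with rfl | he
    · exact hxy
    · exact hM.1 e he
  · rcases Finset.mem_insert.1 he with rfl | he <;> rcases Finset.mem_insert.1 hf with rfl | hf
    · exact absurd rfl hef
    · exact ⟨(hx f hf).symm, (hy f hf).symm⟩
    · exact ⟨hx e he, hy e he⟩
    · exact hM.2 e he f hf hef

/-- The augmentation property of matchings: a matching `G` which is smaller than a matching `H`
can be enlarged to a matching inside `G ∪ H` which covers all that `G` covers. -/
lemma IsMatching.exists_augment {L R : Type*} [DecidableEq L] [DecidableEq R] {E : L → R → Prop}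
    (G H : Finset (L × R)) (hG : IsMatching E G) (hH : IsMatching E H) (hGH : G.card < H.card) :
    ∃ G' : Finset (L × R), IsMatching E G' ∧ G' ⊆ G ∪ H ∧ G'.card = G.card + 1 ∧
      G.image Prod.fst ⊆ G'.image Prod.fst ∧ G.image Prod.snd ⊆ G'.image Prod.snd := by
  induction hn : H.card generalizing G H with
  | zero => omega
  | succ n ih =>
    obtain ⟨x₀, hx₀H, hx₀G⟩ : ∃ x₀ ∈ H.image Prod.fst, x₀ ∉ G.image Prod.fst := by
      by_contra hcon
      push Not at hcon
      have := Finset.card_le_card (show H.image Prod.fst ⊆ G.image Prod.fst from hcon)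
      rw [hG.card_left, hH.card_left] at this
      omega
    obtain ⟨⟨x, y₀⟩, hxy, rfl⟩ := Finset.mem_image.1 hx₀H
    simp only [Finset.mem_image, not_exists, not_and] at hx₀G
    by_cases hy₀ : ∃ e ∈ G, e.2 = y₀
    · obtain ⟨⟨x₁, y₁⟩, he, rfl⟩ := hy₀
      have hne : x₁ ≠ x := hx₀G _ he
      -- Shorten the alternating path: remove the `H`-edge at `x` and the `G`-edge that meets it in
      -- `y₁`. The matching from the induction avoids both `x` and `y₁`, so one of the two removed
      -- edges can be put back; which one depends on whether `x₁` still needs covering.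
      obtain ⟨G', hG', hsub, hcard, hl, hr⟩ := ih (G.erase (x₁, y₁)) (H.erase (x, y₁))
        (hG.mono (Finset.erase_subset _ _) fun e he => hG.1 e (Finset.mem_of_mem_erase he))
        (hH.mono (Finset.erase_subset _ _) fun e he => hH.1 e (Finset.mem_of_mem_erase he))
        (by
          have := Finset.card_pos.2 ⟨_, he⟩
          rw [Finset.card_erase_of_mem he, Finset.card_erase_of_mem hxy]; omega)
        (by rw [Finset.card_erase_of_mem hxy]; omega)
      have hpos := Finset.card_pos.2 ⟨_, he⟩
      rw [Finset.card_erase_of_mem he] at hcard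
      have hy' : ∀ e ∈ G', e.2 ≠ y₁ := by
        intro e he' h
        rcases Finset.mem_union.1 (hsub he') with h' | h' <;> rw [Finset.mem_erase] at h'
        · exact (hG.2 e h'.2 _ he h'.1).2 h
        · exact (hH.2 e h'.2 _ hxy h'.1).2 h
      have hx' : ∀ e ∈ G', e.1 ≠ x := by
        intro e he' h
        rcases Finset.mem_union.1 (hsub he') with h' | h' <;> rw [Finset.mem_erase] at h'
        · exact hx₀G e h'.2 h
        · exact (hH.2 e h'.2 _ hxy h'.1).1 h
      have hsub' : G' ⊆ G ∪ H := hsub.trans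
        (Finset.union_subset_union (Finset.erase_subset _ _) (Finset.erase_subset _ _))
      have hr' : ∀ z, G.image Prod.snd ⊆ (Insert.insert (z, y₁) G').image Prod.snd := by
        intro z w hw
        obtain ⟨e, he', rfl⟩ := Finset.mem_image.1 hw
        rw [Finset.image_insert]
        by_cases h : e = (x₁, y₁)
        · subst h; exact Finset.mem_insert_self _ _
        · exact Finset.mem_insert_of_mem
            (hr (Finset.mem_image_of_mem _ (Finset.mem_erase.2 ⟨h, he'⟩)))
      by_cases hx₁ : ∃ e ∈ G', e.1 = x₁
      · refine ⟨Insert.insert (x, y₁) G', hG'.insert (hH.1 _ hxy) hx' hy', ?_, ?_, ?_, hr' x⟩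
        · exact Finset.insert_subset (Finset.mem_union_right _ hxy) hsub'
        · rw [Finset.card_insert_of_notMem fun h => hx' _ h rfl]; omega
        · intro w hw
          obtain ⟨e, he', rfl⟩ := Finset.mem_image.1 hw
          rw [Finset.image_insert]
          refine Finset.mem_insert_of_mem ?_
          by_cases h : e = (x₁, y₁)
          · subst h
            obtain ⟨f, hf, hf'⟩ := hx₁
            exact Finset.mem_image.2 ⟨f, hf, hf'⟩
          · exact hl (Finset.mem_image_of_mem _ (Finset.mem_erase.2 ⟨h, he'⟩))
      · push Not at hx₁
        refine ⟨Insert.insert (x₁, y₁) G', hG'.insert (hG.1 _ he) hx₁ hy', ?_, ?_, ?_, hr' x₁⟩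
        · exact Finset.insert_subset (Finset.mem_union_left _ he) hsub'
        · rw [Finset.card_insert_of_notMem fun h => hy' _ h rfl]; omega
        · intro w hw
          obtain ⟨e, he', rfl⟩ := Finset.mem_image.1 hw
          rw [Finset.image_insert]
          by_cases h : e = (x₁, y₁)
          · subst h; exact Finset.mem_insert_self _ _
          · exact Finset.mem_insert_of_mem
              (hl (Finset.mem_image_of_mem _ (Finset.mem_erase.2 ⟨h, he'⟩)))
    · push Not at hy₀
      refine ⟨Insert.insert (x, y₀) G, hG.insert (hH.1 _ hxy) hx₀G hy₀, ?_, ?_, ?_, ?_⟩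
      · exact Finset.insert_subset (Finset.mem_union_right _ hxy) Finset.subset_union_left
      · rw [Finset.card_insert_of_notMem fun h => hy₀ _ h rfl]
      · exact Finset.image_subset_image (Finset.subset_insert _ _)
      · exact Finset.image_subset_image (Finset.subset_insert _ _)

/-- The edges `y → x` of a matching, `(x, y) ∈ C`, form disjoint paths and cycles. The permutation
`ω` maps the start of each path to its end. -/
lemma IsMatching.exists_pathEnd {X : Type*} [DecidableEq X] {E : X → X → Prop} (C : Finset (X × X))
    (hC : IsMatching E C) : ∃ ω : Equiv.Perm X, (∀ e ∈ C, ω e.1 = e.2) ∧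
      ∀ x, (∀ e ∈ C, e.1 ≠ x) → (∀ e ∈ C, e.2 ≠ ω x) ∧
        Relation.ReflTransGen (fun y x => E x y) x (ω x) := by
  induction C using Finset.induction_on with
  | empty => exact ⟨1, by simp, fun x _ => ⟨by simp, Relation.ReflTransGen.refl⟩⟩
  | insert a C ha ih =>
    obtain ⟨x, y⟩ := a
    obtain ⟨ω, h1, h2⟩ := ih (hC.mono (Finset.subset_insert _ _)
      fun e he => hC.1 e (Finset.mem_insert_of_mem he))
    have hself := Finset.mem_insert_self (x, y) C
    have hx : ∀ e ∈ C, e.1 ≠ x := fun e he => (hC.2 e (Finset.mem_insert_of_mem he) _ hself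
      (fun h => ha (h ▸ he))).1
    have hy : ∀ e ∈ C, e.2 ≠ y := fun e he => (hC.2 e (Finset.mem_insert_of_mem he) _ hself
      (fun h => ha (h ▸ he))).2
    have hxy : E x y := hC.1 _ hself
    obtain ⟨h3, h4⟩ := h2 x hx
    -- The new edge glues the path ending in `y`, if there is one other than the path from `x`, to
    -- the path starting at `x`: the start of the former now ends in `ω x`, while `x` is sent to its
    -- predecessor `y`. If `ω x = y`, a path closes to a cycle and the swap is trivial.
    refine ⟨Equiv.swap y (ω x) * ω, ?_, ?_⟩
    · intro e he
      rw [Equiv.Perm.mul_apply]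
      rcases Finset.mem_insert.1 he with rfl | he
      · exact Equiv.swap_apply_right _ _
      · rw [h1 e he, Equiv.swap_apply_of_ne_of_ne (hy e he) (h3 e he)]
    · intro s hs
      have hsx : x ≠ s := hs _ hself
      obtain ⟨h5, h6⟩ := h2 s fun e he => hs e (Finset.mem_insert_of_mem he)
      rw [Equiv.Perm.mul_apply]
      by_cases hsy : ω s = y
      · rw [hsy, Equiv.swap_apply_left]
        refine ⟨fun e he => ?_, ?_⟩
        · rcases Finset.mem_insert.1 he with rfl | he
          · rw [← hsy]; exact fun h => hsx (ω.injective h).symm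
          · exact h3 e he
        · rw [hsy] at h6
          exact (h6.tail hxy).trans h4
      · rw [Equiv.swap_apply_of_ne_of_ne hsy fun h => hsx (ω.injective h).symm]
        refine ⟨fun e he => ?_, h6⟩
        rcases Finset.mem_insert.1 he with rfl | he
        · exact fun h => hsy h.symm
        · exact h5 e he

/-! ### Realizations generated from one vertex -/

/-- No nonzero complex covector supported on `U` annihilates all the vectors `A ^ j e_r`. -/
def GeneratesOn {V : Type*} [Fintype V] [DecidableEq V] (A : Matrix V V ℂ) (r : V)
    (U : Set V) : Prop :=
  ∀ v : V → ℂ, (∀ x, x ∉ U → v x = 0) → (∀ j : ℕ, (Matrix.vecMul v (A ^ j)) r = 0) → v = 0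

open Matrix in
/-- If a nonzero covector supported on `U` annihilates all `A ^ j e_r`, then so does a left
eigenvector of `A`, provided that the columns of `A` outside `U` vanish. -/
lemma exists_eigen_of_not_generatesOn {V : Type*} [Fintype V] [DecidableEq V]
    {A : Matrix V V ℂ} {r : V} {U : Set V} (hA : ∀ x y, y ∉ U → A x y = 0)
    (h : ¬ GeneratesOn A r U) :
    ∃ (v : V → ℂ) (l : ℂ), v ≠ 0 ∧ (∀ x, x ∉ U → v x = 0) ∧ v r = 0 ∧ v ᵥ* A = l • v := by
  -- The annihilating covectors form a subspace invariant under `v ↦ v ᵥ* A`; over `ℂ` it contains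
  -- an eigenvector as soon as it is nonzero.
  let K : Submodule ℂ (V → ℂ) :=
    { carrier := {v | (∀ x, x ∉ U → v x = 0) ∧ ∀ j : ℕ, (v ᵥ* (A ^ j)) r = 0}
      add_mem' := by
        rintro a b ⟨ha, ha'⟩ ⟨hb, hb'⟩
        exact ⟨fun x hx => by simp [ha x hx, hb x hx],
          fun j => by simp [Matrix.add_vecMul, ha' j, hb' j]⟩
      zero_mem' := ⟨fun _ _ => rfl, fun j => by simp⟩
      smul_mem' := by
        rintro c a ⟨ha, ha'⟩
        exact ⟨fun x hx => by simp [ha x hx], fun j => by simp [Matrix.smul_vecMul, ha' j]⟩ }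
  have hmap : ∀ v ∈ K, A.vecMulLinear v ∈ K := by
    rintro v ⟨hv, hv'⟩
    refine ⟨fun x hx => ?_, fun j => ?_⟩
    · simp [Matrix.vecMul, dotProduct, hA _ x hx]
    · have := hv' (j + 1)
      rw [pow_succ', ← Matrix.vecMul_vecMul] at this
      simpa using this
  have hne : Nontrivial K := by
    unfold GeneratesOn at h
    push Not at h
    obtain ⟨v, h1, h2, h3⟩ := h
    exact ⟨⟨⟨v, h1, h2⟩, 0, fun h => h3 (congrArg Subtype.val h)⟩⟩
  obtain ⟨l, hl⟩ := Module.End.exists_eigenvalue (A.vecMulLinear.restrict hmap)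
  obtain ⟨v, hv⟩ := hl.exists_hasEigenvector
  refine ⟨v.1, l, fun h => hv.2 (Subtype.ext h), v.2.1, ?_, ?_⟩
  · simpa using v.2.2 0
  · have := congrArg Subtype.val hv.apply_eq_smul
    simpa using this

open Matrix in
lemma norm_vecMul_apply_le {V : Type*} [Fintype V] (D : Matrix V V ℂ) (u : V → ℂ) (y : V) :
    ‖(u ᵥ* D) y‖ ≤ (∑ x, ∑ z, ‖D x z‖) * ‖u‖ := by
  rw [Finset.sum_mul]
  refine (norm_sum_le _ _).trans (Finset.sum_le_sum fun x _ => ?_)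
  rw [norm_mul, mul_comm]
  gcongr
  · exact Finset.single_le_sum (f := fun z => ‖D x z‖) (fun _ _ => norm_nonneg _)
      (Finset.mem_univ y)
  · exact norm_le_pi_norm u x

open Matrix Classical in
/-- A resolvent estimate: if `u (l - A)` is a multiple of `e_y`, if `u` vanishes at `r`, and if some
`A ^ j e_r` does not vanish at `y`, then `u (l - A) = 0` for all large `l`. -/
lemma exists_bound_resolvent {V : Type*} [Fintype V] [DecidableEq V] (A : Matrix V V ℂ) (r y : V)
    (h : ∃ j : ℕ, (A ^ j) y r ≠ 0) :
    ∃ w₀ : ℝ, 0 ≤ w₀ ∧ ∀ (l c : ℂ) (u : V → ℂ), w₀ < ‖l‖ → u r = 0 →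
      u ᵥ* A = l • u - c • Pi.single y 1 → c = 0 := by
  set j := Nat.find h with hj
  have hg : (A ^ j) y r ≠ 0 := Nat.find_spec h
  have hmin : ∀ m < j, (A ^ m) y r = 0 := fun m hm => not_not.mp (Nat.find_min h hm)
  set a : ℝ := ∑ x, ∑ z, ‖A x z‖ with ha
  set K : ℝ := ∑ x, ∑ z, ‖(A ^ (j + 1)) x z‖ with hK
  have ha0 : 0 ≤ a := by positivity
  have hK0 : 0 ≤ K := by positivity
  have hg0 : 0 < ‖(A ^ j) y r‖ := norm_pos_iff.mpr hg
  -- With `g = (A ^ j) y r` for the least possible `j`, iterating the relation gives `‖c‖ * ‖g‖ ≤ K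
  -- * ‖u‖`, and taking norms gives `(‖l‖ - a) * ‖u‖ ≤ ‖c‖`. Beyond this bound the two force `c =
  -- 0`.
  refine ⟨a + K / ‖(A ^ j) y r‖, by positivity, fun l c u hl hu hA => ?_⟩
  have step : ∀ m, (u ᵥ* A ^ (m + 1)) r = l * (u ᵥ* A ^ m) r - c * (A ^ m) y r := by
    intro m
    rw [pow_succ', ← Matrix.vecMul_vecMul, hA, Matrix.sub_vecMul, Matrix.smul_vecMul,
      Matrix.smul_vecMul]
    simp
  have hz : ∀ m ≤ j, (u ᵥ* A ^ m) r = 0 := by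
    intro m
    induction m with
    | zero => intro _; simpa using hu
    | succ m ih => intro hm; rw [step, ih (by omega), hmin m (by omega)]; simp
  have h1 : ‖c‖ * ‖(A ^ j) y r‖ ≤ K * ‖u‖ := by
    have := norm_vecMul_apply_le (A ^ (j + 1)) u r
    rwa [step, hz j le_rfl, mul_zero, zero_sub, norm_neg, norm_mul] at this
  have h2 : ‖l‖ * ‖u‖ ≤ a * ‖u‖ + ‖c‖ := by
    have : l • u = u ᵥ* A + c • Pi.single y 1 := by rw [hA]; simp
    rw [← norm_smul, this]
    refine (norm_add_le _ _).trans (add_le_add ?_ ?_)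
    · exact (pi_norm_le_iff_of_nonneg (by positivity)).mpr fun z => norm_vecMul_apply_le A u z
    · rw [norm_smul]
      refine mul_le_of_le_one_right (norm_nonneg _) ?_
      refine (pi_norm_le_iff_of_nonneg zero_le_one).mpr fun z => ?_
      by_cases hzy : z = y
      · subst hzy; simp
      · simp [hzy]
  by_contra hc
  have hc0 : 0 < ‖c‖ := norm_pos_iff.mpr hc
  have h3 : K < (‖l‖ - a) * ‖(A ^ j) y r‖ := by
    rw [← div_lt_iff₀ hg0]; linarith
  have hla : 0 < ‖l‖ - a := by
    have : 0 ≤ K / ‖(A ^ j) y r‖ := by positivity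
    linarith
  have h4 : (‖l‖ - a) * (‖c‖ * ‖(A ^ j) y r‖) ≤ K * ‖c‖ := by
    calc (‖l‖ - a) * (‖c‖ * ‖(A ^ j) y r‖) ≤ (‖l‖ - a) * (K * ‖u‖) := by gcongr
      _ = K * ((‖l‖ - a) * ‖u‖) := by ring
      _ ≤ K * ‖c‖ := by gcongr; linarith
  nlinarith

open Matrix Classical in
/-- Attaching a cycle `C` of `π` of large weight by one edge preserves generation. -/
lemma GeneratesOn.attach_cycle {V : Type*} [Fintype V] [DecidableEq V] {A : Matrix V V ℂ} {r : V}
    {U C : Set V} (hgen : GeneratesOn A r U) (hA : ∀ x y, A x y ≠ 0 → x ∈ U ∧ y ∈ U)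
    (π : Equiv.Perm V) {x₀ y₀ : V} (hC : C = {x | π.SameCycle x x₀}) (hd : ∀ x ∈ C, x ∉ U)
    (hy₀ : y₀ ∈ U) :
    ∃ w : ℝ, GeneratesOn (Matrix.of fun x y => A x y + ((if x ∈ C ∧ y = π x then (w : ℂ) else 0)
      + if x = x₀ ∧ y = y₀ then 1 else 0)) r (U ∪ C) := by
  have hx₀ : x₀ ∈ C := by rw [hC]; exact Equiv.Perm.SameCycle.refl _ _
  have hπ : ∀ x, π x ∈ C ↔ x ∈ C := fun x => by
    rw [hC]; exact Equiv.Perm.sameCycle_apply_left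
  have hA0 : ∀ x y, y ∉ U → A x y = 0 := fun x y hy => by
    by_contra h; exact hy (hA x y h).2
  have hA1 : ∀ x y, x ∉ U → A x y = 0 := fun x y hy => by
    by_contra h; exact hy (hA x y h).1
  -- Some `A ^ j e_r` is nonzero at `y₀`, for otherwise the unit covector at `y₀` would contradict
  -- generation on `U`.
  obtain ⟨w₀, hw₀, hres⟩ := exists_bound_resolvent A r y₀ (by
    by_contra hcon
    push Not at hcon
    have := hgen (Pi.single y₀ 1) (fun x hx => by
      rw [Pi.single_eq_of_ne]; rintro rfl; exact hx hy₀) (fun j => by simpa using hcon j)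
    have := congrFun this y₀
    simp at this)
  refine ⟨w₀ + 1, ?_⟩
  set w : ℝ := w₀ + 1 with hw
  have hwpos : 0 < w := by linarith
  have hwne : (w : ℂ) ≠ 0 := by exact_mod_cast hwpos.ne'
  set B : Matrix V V ℂ := Matrix.of fun x y => A x y + ((if x ∈ C ∧ y = π x then (w : ℂ) else 0)
      + if x = x₀ ∧ y = y₀ then 1 else 0) with hB
  by_contra hcon
  obtain ⟨v, l, hv0, hvs, hvr, hvl⟩ := exists_eigen_of_not_generatesOn (fun x y hy => by
    have h1 : y ∉ U := fun h => hy (Or.inl h)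
    have h2 : ¬ (x ∈ C ∧ y = π x) := by
      rintro ⟨h, rfl⟩; exact hy (Or.inr ((hπ x).2 h))
    have h3 : ¬ (x = x₀ ∧ y = y₀) := by rintro ⟨-, rfl⟩; exact h1 hy₀
    simp [hB, hA0 x y h1, h2, h3]) hcon
  have hcol : ∀ y, l * v y = (v ᵥ* A) y + ((∑ x, v x * (if x ∈ C ∧ y = π x then (w : ℂ) else 0)) +
      if y = y₀ then v x₀ else 0) := by
    intro y
    have := congrFun hvl y
    simp only [Pi.smul_apply, smul_eq_mul] at this
    rw [← this]
    simp only [hB, Matrix.vecMul, dotProduct, Matrix.of_apply, mul_add, Finset.sum_add_distrib]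
    congr 2
    by_cases h : y = y₀ <;> simp [h]
  have hcyc : ∀ x ∈ C, l * v (π x) = w * v x := by
    intro x hx
    have hx' : π x ∉ U := hd _ ((hπ x).2 hx)
    rw [hcol, if_neg (show π x ≠ y₀ from fun h => hx' (h ▸ hy₀)), Finset.sum_eq_single x]
    · have : (v ᵥ* A) (π x) = 0 := by simp [Matrix.vecMul, dotProduct, hA0 _ _ hx']
      rw [this]; simp [hx, mul_comm]
    · intro z _ hz; rw [if_neg]; · simp
      rintro ⟨_, h⟩; exact hz (π.injective h).symm
    · simp
  have hcyc' : ∀ (i : ℕ), ∀ x ∈ C, l ^ i * v ((π ^ i) x) = (w : ℂ) ^ i * v x := by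
    intro i
    induction i with
    | zero => simp
    | succ i ih =>
      intro x hx
      have := ih (π x) ((hπ x).2 hx)
      rw [pow_succ π i, Equiv.Perm.mul_apply, pow_succ l, mul_right_comm, this, mul_assoc, mul_comm (v _) l,
        hcyc x hx]
      ring
  -- If `v x₀ = 0`, then `v` vanishes along the cycle and is an eigenvector of `A` that contradicts
  -- generation on `U`. Otherwise, going around the cycle gives `‖l‖ = w`, beyond the resolvent
  -- bound for the restriction of `v` to `U`, whose defect is `v x₀` at `y₀`.
  by_cases hvx : v x₀ = 0
  · have hvC : ∀ x ∈ C, v x = 0 := by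
      intro x hx
      have hx' := hx
      rw [hC] at hx'
      obtain ⟨i, -, hi⟩ := Equiv.Perm.SameCycle.exists_pow_eq' hx'
      have := hcyc' i x hx
      rw [hi, hvx, mul_zero, eq_comm, mul_eq_zero] at this
      exact this.resolve_left (pow_ne_zero _ hwne)
    have hvA : v ᵥ* A = l • v := by
      funext y
      have := hcol y
      rw [hvx, Finset.sum_eq_zero] at this
      · simpa using this.symm
      · intro x _
        by_cases hx : x ∈ C
        · simp [hvC x hx]
        · simp [hx]
    refine hv0 (hgen v (fun x hx => ?_) fun j => ?_)
    · by_cases hxC : x ∈ C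
      · exact hvC x hxC
      · exact hvs x (by simp [hx, hxC])
    · have : v ᵥ* A ^ j = l ^ j • v := by
        induction j with
        | zero => simp
        | succ j ih =>
          rw [pow_succ, ← Matrix.vecMul_vecMul, ih, Matrix.smul_vecMul, hvA, smul_smul, pow_succ]
      rw [this]; simp [hvr]
  · have hnorm : ‖l‖ = w := by
      have h1 := hcyc' (orderOf π) x₀ hx₀
      rw [pow_orderOf_eq_one, Equiv.Perm.one_apply] at h1
      have h2 := mul_right_cancel₀ hvx h1
      have h3 := congrArg norm h2
      rw [norm_pow, norm_pow, Complex.norm_of_nonneg hwpos.le] at h3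
      exact (pow_left_inj₀ (norm_nonneg _) hwpos.le (orderOf_pos π).ne').mp h3
    refine hvx (hres l (v x₀) (fun x => if x ∈ U then v x else 0) (by rw [hnorm]; linarith)
      (by simp [hvr]) ?_)
    funext y
    have hsum : ((fun x => if x ∈ U then v x else 0) ᵥ* A) y = (v ᵥ* A) y := by
      refine Finset.sum_congr rfl fun x _ => ?_
      by_cases hx : x ∈ U
      · simp [hx]
      · simp [hA1 x y hx]
    rw [hsum]
    by_cases hy : y ∈ U
    · have := hcol y
      rw [Finset.sum_eq_zero] at this
      · by_cases hyy : y = y₀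
        · subst hyy; simp [hy, this]
        · simp [hy, this, hyy]
      · intro x _
        rw [if_neg, mul_zero]
        rintro ⟨hx, rfl⟩
        exact hd _ ((hπ x).2 hx) hy
    · have hyy : y ≠ y₀ := fun h => hy (h ▸ hy₀)
      simp [hy, hyy, Matrix.vecMul, dotProduct, hA0 _ _ hy]

open Matrix Classical in
/-- The vectors `A ^ j e_r` generate along the cycle of `π` through `r`, for the matrix `A` of that
cycle with its edge into `r` removed. -/
lemma generatesOn_stem {V : Type*} [Fintype V] [DecidableEq V] (π : Equiv.Perm V) (r : V) :
    GeneratesOn (Matrix.of fun x y => if π.SameCycle x r ∧ x ≠ r ∧ y = π x then (1 : ℂ) else 0) r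
      {x | π.SameCycle x r} := by
  set A : Matrix V V ℂ :=
    Matrix.of fun x y => if π.SameCycle x r ∧ x ≠ r ∧ y = π x then (1 : ℂ) else 0 with hA
  -- Along the stem, `A ^ j e_r` is the unit vector at the vertex that `π` first takes to `r` after
  -- `j` steps.
  have key : ∀ (j : ℕ) (x : V), (∀ i < j, (π ^ i) x ≠ r) → (π ^ j) x = r →
      ∀ z, (A ^ j) z r = if z = x then 1 else 0 := by
    intro j
    induction j with
    | zero =>
      intro x _ hx z
      have : x = r := by simpa using hx
      subst this
      simp [Matrix.one_apply]
    | succ j ih =>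
      intro x h1 h2 z
      have h3 : (π ^ j) (π x) = r := by rw [← h2, pow_succ, Equiv.Perm.mul_apply]
      have h4 := ih (π x) (fun i hi => by
        have := h1 (i + 1) (by omega)
        rwa [pow_succ, Equiv.Perm.mul_apply] at this) h3
      have hxr : x ≠ r := by simpa using h1 0 (by omega)
      have hsc : π.SameCycle x r := ⟨(j + 1 : ℕ), by rw [zpow_natCast]; exact h2⟩
      rw [pow_succ', Matrix.mul_apply]
      simp only [h4, mul_ite, mul_one, mul_zero, Finset.sum_ite_eq', Finset.mem_univ, if_true]
      simp only [hA, Matrix.of_apply]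
      by_cases hz : z = x
      · subst hz; simp [hsc, hxr]
      · rw [if_neg, if_neg hz]
        rintro ⟨_, _, h⟩; exact hz (π.injective h).symm
  intro v hv hj
  funext x
  by_cases hx : π.SameCycle x r
  · have hex : ∃ i : ℕ, (π ^ i) x = r := by
      obtain ⟨i, -, hi⟩ := Equiv.Perm.SameCycle.exists_pow_eq' hx
      exact ⟨i, hi⟩
    have := hj (Nat.find hex)
    simp only [Matrix.vecMul, dotProduct] at this
    simpa [key (Nat.find hex) x (fun i hi => Nat.find_min hex hi) (Nat.find_spec hex)] using this
  · exact hv x hx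

open Matrix Classical in
/-- A digraph all of whose vertices are reachable from `r`, and which contains all edges
`π x → x`, `x ≠ r`, of a permutation `π`, supports a real matrix `A` for which the vectors
`A ^ j e_r` span. -/
theorem exists_generating_matrix {V : Type*} [Fintype V] [DecidableEq V] (G : V → V → Prop) (r : V)
    (π : Equiv.Perm V) (hπ : ∀ x, x ≠ r → G (π x) x) (hG : ∀ x, Relation.ReflTransGen G r x) :
    ∃ A : Matrix V V ℝ, (∀ x y, A x y ≠ 0 → G y x) ∧
      GeneratesOn (A.map ((↑) : ℝ → ℂ)) r Set.univ := by
  -- Grow a `π`-invariant set `U`, beginning with the cycle of `r`. Reachability supplies an edge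
  -- leaving `U`, and the whole cycle of its end is attached.
  suffices h : ∀ (m : ℕ) (U : Set V) (A : Matrix V V ℝ), Uᶜ.ncard = m → r ∈ U →
      (∀ x, π x ∈ U ↔ x ∈ U) → (∀ x y, A x y ≠ 0 → G y x ∧ x ∈ U ∧ y ∈ U) →
      GeneratesOn (A.map ((↑) : ℝ → ℂ)) r U →
      ∃ A : Matrix V V ℝ, (∀ x y, A x y ≠ 0 → G y x) ∧
        GeneratesOn (A.map ((↑) : ℝ → ℂ)) r Set.univ by
    refine h _ {x | π.SameCycle x r}
      (Matrix.of fun x y => if π.SameCycle x r ∧ x ≠ r ∧ y = π x then (1 : ℝ) else 0) rfl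
      (Equiv.Perm.SameCycle.refl _ _) (fun x => Equiv.Perm.sameCycle_apply_left) ?_ ?_
    · intro x y hxy
      have : π.SameCycle x r ∧ x ≠ r ∧ y = π x := by
        by_contra hcon
        exact hxy (by simp only [Matrix.of_apply, if_neg hcon])
      obtain ⟨h1, h2, rfl⟩ := this
      exact ⟨hπ x h2, h1, Equiv.Perm.sameCycle_apply_left.2 h1⟩
    · convert generatesOn_stem π r using 1
      ext x y
      simp only [Matrix.map_apply, Matrix.of_apply]
      split_ifs <;> simp
  intro m
  induction m using Nat.strong_induction_on with
  | _ m ih =>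
    intro U A hm hr hU hA hgen
    by_cases huniv : U = Set.univ
    · exact ⟨A, fun x y h => (hA x y h).1, huniv ▸ hgen⟩
    obtain ⟨z, hz⟩ := (Set.ne_univ_iff_exists_notMem U).1 huniv
    obtain ⟨y₀, x₀, hy₀, hx₀, hG₀⟩ : ∃ y x, y ∈ U ∧ x ∉ U ∧ G y x := by
      by_contra hcon
      push Not at hcon
      have : ∀ x, Relation.ReflTransGen G r x → x ∈ U := by
        intro x hx
        induction hx with
        | refl => exact hr
        | tail _ h1 h2 =>
          by_contra h3
          exact hcon _ _ h2 h3 h1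
      exact hz (this z (hG z))
    have hpow : ∀ x, x ∈ U → ∀ i : ℕ, (π ^ i) x ∈ U := by
      intro x hx i
      induction i with
      | zero => simpa using hx
      | succ i hi => rw [pow_succ', Equiv.Perm.mul_apply]; exact (hU _).2 hi
    have hd : ∀ x ∈ {x | π.SameCycle x x₀}, x ∉ U := by
      intro x hx hxU
      obtain ⟨i, -, hi⟩ := Equiv.Perm.SameCycle.exists_pow_eq' hx
      exact hx₀ (hi ▸ hpow x hxU i)
    have hx₀C : x₀ ∈ {x | π.SameCycle x x₀} := Equiv.Perm.SameCycle.refl _ _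
    obtain ⟨w, hw⟩ := hgen.attach_cycle (fun x y hxy => (hA x y (by simpa using hxy)).2) π rfl
      hd hy₀
    refine ih _ ?_ (U ∪ {x | π.SameCycle x x₀}) (Matrix.of fun x y => A x y +
      ((if x ∈ {x | π.SameCycle x x₀} ∧ y = π x then w else 0)
      + if x = x₀ ∧ y = y₀ then 1 else 0)) rfl (Or.inl hr) ?_ ?_ ?_
    · rw [← hm]
      refine Set.ncard_lt_ncard ⟨Set.compl_subset_compl.2 Set.subset_union_left, fun h => ?_⟩
        (Set.toFinite _)
      exact h hx₀ (Or.inr hx₀C)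
    · intro x
      exact or_congr (hU x) Equiv.Perm.sameCycle_apply_left
    · intro x y hxy
      by_cases h1 : A x y = 0
      · by_cases h2 : x ∈ {x | π.SameCycle x x₀} ∧ y = π x
        · obtain ⟨h2, rfl⟩ := h2
          exact ⟨hπ x (fun h => hd x h2 (h ▸ hr)), Or.inr h2,
            Or.inr (Equiv.Perm.sameCycle_apply_left.2 h2)⟩
        · by_cases h3 : x = x₀ ∧ y = y₀
          · obtain ⟨rfl, rfl⟩ := h3
            exact ⟨hG₀, Or.inr hx₀C, Or.inl hy₀⟩
          · exact absurd (by simp only [Matrix.of_apply, h1, if_neg h2, if_neg h3, add_zero]) hxy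
      · obtain ⟨h2, h3, h4⟩ := hA x y h1
        exact ⟨h2, Or.inl h3, Or.inl h4⟩
    · convert hw using 1
      ext x y
      simp only [Matrix.map_apply, Matrix.of_apply]
      split_ifs <;> simp

/-! ### Structural controllability: accessibility and distinct predecessors -/

open Matrix in
-- Full row rank means that no nonzero row vector annihilates the controllability matrix. By
-- Cayley–Hamilton, annihilating the first powers already means annihilating all of them.
lemma isControllable_iff {ι κ : Type*} [Fintype ι] [DecidableEq ι] [Fintype κ]
    (A : Matrix ι ι ℝ) (B : Matrix ι κ ℝ) :
    IsControllable A B ↔ ∀ v : ι → ℝ, (∀ j : ℕ, v ᵥ* (A ^ j * B) = 0) → v = 0 := by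
  have h1 : IsControllable A B ↔ LinearIndependent ℝ (controllabilityMatrix A B).row := by
    rw [linearIndependent_iff_card_eq_finrank_span, Set.finrank, IsControllable,
      Matrix.rank_eq_finrank_span_row, eq_comm]
  have h2 : ∀ v : ι → ℝ, v ᵥ* controllabilityMatrix A B = 0 ↔
      ∀ j < Fintype.card ι, v ᵥ* (A ^ j * B) = 0 := by
    intro v
    constructor
    · intro h j hj
      funext c
      exact congrFun h (⟨j, hj⟩, c)
    · intro h
      funext c
      exact congrFun (h c.1 c.1.2) c.2
  have h3 : ∀ v : ι → ℝ, (∀ j < Fintype.card ι, v ᵥ* (A ^ j * B) = 0) →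
      ∀ j, v ᵥ* (A ^ j * B) = 0 := by
    intro v hv j
    have hlin : ∀ p : Polynomial ℝ, p.natDegree < Fintype.card ι ∨ p = 0 →
        v ᵥ* (Polynomial.aeval A p * B) = 0 := by
      rintro p (hp | rfl)
      · rw [Polynomial.aeval_eq_sum_range, Matrix.sum_mul, Matrix.vecMul_sum]
        refine Finset.sum_eq_zero fun i hi => ?_
        rw [Matrix.smul_mul, Matrix.vecMul_smul, hv i (by rw [Finset.mem_range] at hi; omega),
          smul_zero]
      · simp
    rw [Matrix.pow_eq_aeval_mod_charpoly]
    refine hlin _ ?_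
    by_cases h0 : (Polynomial.X ^ j %ₘ A.charpoly) = 0
    · exact Or.inr h0
    · left
      have := Polynomial.degree_modByMonic_lt (Polynomial.X ^ j) A.charpoly_monic
      rw [← Polynomial.natDegree_lt_natDegree_iff h0] at this
      rwa [Matrix.charpoly_natDegree_eq_dim] at this
  rw [h1, ← Matrix.vecMul_injective_iff, ← Matrix.coe_vecMulLinear, injective_iff_map_eq_zero]
  refine forall_congr' fun v => ?_
  rw [Matrix.vecMulLinear_apply, h2]
  exact ⟨fun h hv => h fun j _ => hv j, fun h hv => h (h3 v hv)⟩

/-- Every state of a structurally controllable pair is accessible. -/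
lemma IsStructurallyControllable.isAccessible {ι κ : Type*} [Fintype ι] [DecidableEq ι]
    [Fintype κ] {P : Pattern ι ι} {Q : Pattern ι κ} (h : IsStructurallyControllable P Q) (i : ι) :
    IsAccessible P Q i := by
  obtain ⟨A, B, hA, hB, hc⟩ := h
  by_contra hi
  have key : ∀ (j : ℕ) (i : ι), ¬ IsAccessible P Q i → ∀ u, (A ^ j * B) i u = 0 := by
    intro j
    induction j with
    | zero =>
      intro i hi u
      rw [pow_zero, Matrix.one_mul]
      refine hB i u (Bool.eq_false_iff.2 fun h => hi ⟨u, Relation.ReflTransGen.single ?_⟩)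
      exact h
    | succ j ih =>
      intro i hi u
      rw [pow_succ', Matrix.mul_assoc, Matrix.mul_apply]
      refine Finset.sum_eq_zero fun y _ => ?_
      by_cases hy : IsAccessible P Q y
      · obtain ⟨u', hu'⟩ := hy
        rw [hA i y (Bool.eq_false_iff.2 fun h => hi ⟨u', hu'.tail ?_⟩), zero_mul]
        exact h
      · rw [ih y hy, mul_zero]
  have := (isControllable_iff A B).1 hc (Pi.single i 1) fun j => by
    funext u
    simpa using key j i hi u
  simpa using congrFun this i

open Matrix in
/-- In a structurally controllable pair all states can be matched to pairwise distinct
predecessors. -/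
lemma IsStructurallyControllable.exists_injective {ι κ : Type*} [Fintype ι] [DecidableEq ι]
    [Fintype κ] [DecidableEq κ] {P : Pattern ι ι} {Q : Pattern ι κ}
    (h : IsStructurallyControllable P Q) :
    ∃ f : ι → ι ⊕ κ, Function.Injective f ∧ (∀ x y, f x = Sum.inl y → P x y = true) ∧
      ∀ x u, f x = Sum.inr u → Q x u = true := by
  classical
  obtain ⟨A, B, hA, hB, hc⟩ := h
  rw [isControllable_iff] at hc
  let t : ι → Finset (ι ⊕ κ) := fun x => Finset.univ.filter fun s => Matrix.fromCols A B x s ≠ 0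
  -- Controllability makes the rows of `[A B]` independent. The rows in `s` are supported on the
  -- columns in `s.biUnion t`, so there are at least as many of these columns; this is Hall's
  -- condition.
  have hall : ∀ s : Finset ι, s.card ≤ (s.biUnion t).card := by
    intro s
    have hli : LinearIndependent ℝ
        (fun (x : s) (c : s.biUnion t) => Matrix.fromCols A B x.1 c.1) := by
      rw [Fintype.linearIndependent_iff]
      intro g hg
      let v : ι → ℝ := fun x => if hx : x ∈ s then g ⟨x, hx⟩ else 0
      have hv : v ᵥ* Matrix.fromCols A B = 0 := by
        funext c
        have hsum : (v ᵥ* Matrix.fromCols A B) c = ∑ x : s, g x * Matrix.fromCols A B x.1 c := by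
          rw [Matrix.vecMul, dotProduct, ← Finset.sum_subset (Finset.subset_univ s),
            ← Finset.sum_coe_sort s]
          · exact Finset.sum_congr rfl fun x _ => by simp [v]
          · intro x _ hx; simp [v, hx]
        rw [hsum]
        by_cases hcm : c ∈ s.biUnion t
        · have := congrFun hg ⟨c, hcm⟩
          simpa using this
        · refine Finset.sum_eq_zero fun x _ => ?_
          have : Matrix.fromCols A B x.1 c = 0 := by
            by_contra hne
            exact hcm (Finset.mem_biUnion.2 ⟨x.1, x.2, by simp [t, hne]⟩)
          rw [this, mul_zero]
      have hvA : v ᵥ* A = 0 := funext fun y => by simpa using congrFun hv (Sum.inl y)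
      have hvB : v ᵥ* B = 0 := funext fun y => by simpa using congrFun hv (Sum.inr y)
      have hv0 : v = 0 := hc v fun j => by
        cases j with
        | zero => simpa using hvB
        | succ j => rw [pow_succ', Matrix.mul_assoc, ← Matrix.vecMul_vecMul, hvA, Matrix.zero_vecMul]
      intro x
      have := congrFun hv0 x.1
      simpa [v] using this
    simpa only [Module.finrank_fintype_fun_eq_card, Fintype.card_coe] using
      hli.fintype_card_le_finrank
  obtain ⟨f, hf, hft⟩ := (Finset.all_card_le_biUnion_card_iff_exists_injective t).1 hall
  refine ⟨f, hf, fun x y hxy => ?_, fun x u hxu => ?_⟩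
  · have := hft x
    rw [hxy] at this
    by_contra hP
    exact (Finset.mem_filter.1 this).2 (hA x y (Bool.eq_false_iff.2 hP))
  · have := hft x
    rw [hxu] at this
    by_contra hP
    exact (Finset.mem_filter.1 this).2 (hB x u (Bool.eq_false_iff.2 hP))

open Matrix in
/-- A single-input structured pair is structurally controllable if every state is accessible and
the states can be matched to pairwise distinct predecessors. -/
lemma isStructurallyControllable_of_injective {ι : Type*} [Fintype ι] [DecidableEq ι]
    {P : Pattern ι ι} {Q : Pattern ι (Fin 1)} (hacc : ∀ i, IsAccessible P Q i) (f : ι → Option ι)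
    (hf : Function.Injective f) (hP : ∀ x y, f x = some y → P x y = true)
    (hQ : ∀ x, f x = none → Q x 0 = true) : IsStructurallyControllable P Q := by
  classical
  let G : Option ι → Option ι → Prop
    | some y, some x => P x y = true
    | none, some x => Q x 0 = true
    | _, none => False
  -- With the input as the extra vertex `none`, the injection `f` extends to a permutation of all
  -- vertices; its value at `none` is irrelevant, because edges are required only into vertices
  -- other than the root.
  obtain ⟨g, hg⟩ : ∃ g : Option ι ≃ (Finset.univ : Finset (Option ι)),
      ∀ i ∈ Set.range (some : ι → Option ι), (g i : Option ι) = i.elim none f := by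
    refine Set.MapsTo.exists_equiv_extend_of_card_eq (by simp) (fun _ _ => by simp) ?_
    rintro _ ⟨a, rfl⟩ _ ⟨b, rfl⟩ hab
    exact congrArg some (hf hab)
  let π : Equiv.Perm (Option ι) := g.trans (Equiv.subtypeUnivEquiv fun x => Finset.mem_univ x)
  have hπ : ∀ x : ι, π (some x) = f x := fun x => hg (some x) ⟨x, rfl⟩
  have hreach : ∀ z : ι ⊕ Fin 1, Reaches (systemDigraph P Q) (Sum.inr 0) z →
      Relation.ReflTransGen G none (z.elim some fun _ => none) := by
    intro z hz
    induction hz with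
    | refl => exact Relation.ReflTransGen.refl
    | @tail b c _ h ih =>
      refine ih.tail ?_
      rcases b with b | b <;> rcases c with c | c
      · exact h
      · exact h.elim
      · have hb : b = 0 := Subsingleton.elim _ _
        subst hb; exact h
      · exact h.elim
  obtain ⟨M, hM, hgen⟩ := exists_generating_matrix G none π
    (fun x hx => by
      cases x with
      | none => exact absurd rfl hx
      | some x =>
        rw [hπ]
        cases hfx : f x with
        | none => exact hQ x hfx
        | some y => exact hP x y hfx)
    (fun x => by
      cases x with
      | none => exact Relation.ReflTransGen.refl
      | some x =>
        obtain ⟨u, hu⟩ := hacc x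
        have hu0 : u = 0 := Subsingleton.elim _ _
        subst hu0
        exact hreach _ hu)
  refine ⟨Matrix.of fun x y => M (some x) (some y), Matrix.of fun x _ => M (some x) none,
    fun x y h => ?_, fun x u h => ?_, ?_⟩
  · by_contra hne
    have : P x y = true := hM _ _ hne
    simp [h] at this
  · by_contra hne
    have : Q x 0 = true := hM _ _ hne
    rw [Subsingleton.elim u 0] at h
    simp [h] at this
  rw [isControllable_iff]
  intro v hv
  set A : Matrix ι ι ℝ := Matrix.of fun x y => M (some x) (some y) with hA
  set b : Matrix ι (Fin 1) ℝ := Matrix.of fun x _ => M (some x) none with hb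
  have hnone : ∀ y, M none y = 0 := fun y => by
    by_contra hne
    have := hM _ _ hne
    cases y <;> exact this
  -- `M` has the block form with rows `(A, b)` and `0`, so the input column of `M ^ (j + 1)` is `A ^
  -- j b`, with `0` at the input.
  have hpow : ∀ j : ℕ, (M ^ (j + 1)) none none = 0 ∧
      ∀ x, (M ^ (j + 1)) (some x) none = (A ^ j * b) x 0 := by
    intro j
    induction j with
    | zero => simp [hnone, hb]
    | succ j ih =>
      refine ⟨?_, fun x => ?_⟩
      · rw [pow_succ', Matrix.mul_apply]; simp [hnone]
      · rw [pow_succ' M, Matrix.mul_apply, Fintype.sum_option, ih.1, mul_zero, zero_add,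
          pow_succ' A, Matrix.mul_assoc, Matrix.mul_apply]
        exact Finset.sum_congr rfl fun y _ => by rw [ih.2]; rfl
  have := hgen (fun z => z.elim 0 fun x => (v x : ℂ)) (fun x hx => absurd (Set.mem_univ x) hx) (by
    intro j
    have hmap : (M.map ((↑) : ℝ → ℂ)) ^ j = (M ^ j).map ((↑) : ℝ → ℂ) :=
      (Matrix.map_pow M (Complex.ofRealHom) j).symm
    rw [hmap]
    simp only [Matrix.vecMul, dotProduct, Fintype.sum_option, Option.elim_none, zero_mul,
      Option.elim_some, zero_add, Matrix.map_apply]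
    cases j with
    | zero => simp
    | succ j =>
      have h := congrFun (hv j) 0
      simp only [Matrix.vecMul, dotProduct, Pi.zero_apply] at h
      rw [← Complex.ofReal_zero, ← h, Complex.ofReal_sum]
      exact Finset.sum_congr rfl fun x _ => by rw [(hpow j).2, Complex.ofReal_mul])
  funext x
  have := congrFun this (some x)
  simpa using this

/-! ### Lower bound for the number of interconnections -/

/-- The edges of the augmented bipartite graph that are not interconnections. -/
def nonInterconnectionEdge {k n : ℕ} {κ : Type*} (As : Pattern (Fin n) (Fin n))
    (Q : Pattern (Fin k × Fin n) κ) (x : Fin k × Fin n) (r : AugRight As Q) : Prop :=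
  augEdge As Q x r ∧ isInterconnectionEdge As Q (x, r) = false

section Inaccessible

variable {k n : ℕ} {κ : Type*} {As : Pattern (Fin n) (Fin n)} {Q : Pattern (Fin k × Fin n) κ}

lemma inaccessibleSCCs_nonempty {S : Set (Fin k × Fin n)} (hS : S ∈ inaccessibleSCCs As Q) :
    S.Nonempty := by
  obtain ⟨i, T, ⟨v, rfl⟩, -, rfl, -⟩ := hS
  exact ⟨(i, v), v, ⟨Relation.ReflTransGen.refl, Relation.ReflTransGen.refl⟩, rfl⟩

lemma inaccessibleSCCs_eq_of_mem {S S' : Set (Fin k × Fin n)} (hS : S ∈ inaccessibleSCCs As Q)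
    (hS' : S' ∈ inaccessibleSCCs As Q) {x : Fin k × Fin n} (hx : x ∈ S) (hx' : x ∈ S') :
    S = S' := by
  obtain ⟨i, T, ⟨v, rfl⟩, -, rfl, -⟩ := hS
  obtain ⟨j, T', ⟨w, rfl⟩, -, rfl, -⟩ := hS'
  obtain ⟨p, ⟨h1, h2⟩, rfl⟩ := hx
  obtain ⟨p', ⟨h3, h4⟩, h⟩ := hx'
  obtain ⟨rfl, rfl⟩ := Prod.mk.injEq .. ▸ h
  congr 1
  ext z
  exact ⟨fun h => ⟨(h3.trans h2).trans h.1, h.2.trans (h1.trans h4)⟩,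
    fun h => ⟨(h1.trans h4).trans h.1, h.2.trans (h3.trans h2)⟩⟩

/-- If all states of a composite system are accessible, an interconnection enters each
inaccessible non-top linked SCC. -/
lemma IsComposite.exists_entering {P : Pattern (Fin k × Fin n) (Fin k × Fin n)}
    (hP : IsComposite As P) (hacc : ∀ x, IsAccessible P Q x) {S : Set (Fin k × Fin n)}
    (hS : S ∈ inaccessibleSCCs As Q) :
    ∃ x ∈ S, ∃ y : Fin k × Fin n, x.1 ≠ y.1 ∧ P x y = true := by
  obtain ⟨x, hx⟩ := inaccessibleSCCs_nonempty hS
  obtain ⟨u, hu⟩ := hacc x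
  obtain ⟨i, T, -, hT, rfl, hin⟩ := hS
  by_contra hcon
  push Not at hcon
  have key : ∀ z, Reaches (systemDigraph P Q) (Sum.inr u) z →
      ∀ x, z = Sum.inl x → x ∉ (fun p => (i, p)) '' T := by
    intro z hz
    induction hz with
    | refl => intro x h; cases h
    | @tail b c _ h ih =>
      rintro ⟨j, p⟩ rfl hxS
      obtain ⟨p', hp', h'⟩ := id hxS
      obtain ⟨rfl, rfl⟩ := Prod.mk.injEq .. ▸ h'
      rcases b with ⟨l, p''⟩ | u'
      · have hl : i = l := by
          by_contra hne
          exact hcon _ hxS (l, p'') hne h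
        subst hl
        refine hT p'' (fun hp'' => ih _ rfl ⟨p'', hp'', rfl⟩) p' hp' ?_
        exact (hP i p' p'').symm.trans h
      · exact hin _ hxS ⟨u', Relation.ReflTransGen.single h⟩
  exact key _ hu x rfl hx

end Inaccessible

/-- A structurally controllable composite system has at least as many interconnections as some
matching without interconnections leaves states unmatched, plus one for each inaccessible
non-top linked SCC. -/
lemma exists_matching_le_numInterconnections {k n : ℕ} {As : Pattern (Fin n) (Fin n)}
    {B : Pattern (Fin k × Fin n) (Fin 1)} {P : Pattern (Fin k × Fin n) (Fin k × Fin n)}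
    (hP : IsComposite As P) (hc : IsStructurallyControllable P B) :
    ∃ G, IsMatching (nonInterconnectionEdge As B) G ∧
      Fintype.card (Fin k × Fin n) + (inaccessibleSCCs As B).ncard ≤
        numInterconnections P + G.card := by
  classical
  have : Fintype (inaccessibleSCCs As B) := Fintype.ofFinite _
  obtain ⟨f, hf, hfP, hfB⟩ := hc.exists_injective
  choose e he e' hne hPe using fun S : inaccessibleSCCs As B =>
    hP.exists_entering hc.isAccessible S.2
  -- `J` collects the states whose chosen predecessor lies in another subsystem; `hit`, below, the
  -- SCCs that contain such a state.
  let J : Finset (Fin k × Fin n) :=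
    Finset.univ.filter fun x => ∃ y : Fin k × Fin n, f x = Sum.inl y ∧ x.1 ≠ y.1
  have hJ : ∀ x : J, ∃ y : Fin k × Fin n, f x = Sum.inl y ∧ x.1.1 ≠ y.1 := fun x =>
    (Finset.mem_filter.1 x.2).2
  choose s hs hs' using hJ
  let hit : Finset (inaccessibleSCCs As B) := Finset.univ.filter fun S => ∃ x ∈ J, x ∈ S.1
  have hhit : ∀ S : inaccessibleSCCs As B, ∃ x, S ∈ hit → x ∈ J ∧ x ∈ S.1 := fun S => by
    by_cases h : S ∈ hit
    · obtain ⟨x, hx⟩ := (Finset.mem_filter.1 h).2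
      exact ⟨x, fun _ => hx⟩
    · exact ⟨e S, fun h' => absurd h' h⟩
  choose t ht using hhit
  have hdisj : ∀ S S' : inaccessibleSCCs As B, ∀ x, x ∈ S.1 → x ∈ S'.1 → S = S' :=
    fun S S' x h h' => Subtype.ext (inaccessibleSCCs_eq_of_mem S.2 S'.2 h h')
  let emb : (Fin k × Fin n) ⊕ Fin 1 → AugRight As B := Sum.map id Sum.inl
  have hemb : Function.Injective emb := Sum.map_injective.2 ⟨Function.injective_id,
    Sum.inl_injective⟩
  have hemb' : ∀ z S, emb z ≠ Sum.inr (Sum.inr S) := by rintro (z | z) S <;> simp [emb]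
  -- States outside `J` keep their predecessor, and each hit SCC node is matched to one of the
  -- states of `J` inside it.
  let G₁ : Finset ((Fin k × Fin n) × AugRight As B) := Jᶜ.image fun x => (x, emb (f x))
  let G₂ : Finset ((Fin k × Fin n) × AugRight As B) :=
    hit.image fun S => (t S, Sum.inr (Sum.inr S))
  have hG₁ : G₁.card = Fintype.card (Fin k × Fin n) - J.card := by
    rw [Finset.card_image_of_injective _ fun x y h => (Prod.mk.inj h).1, Finset.card_compl]
  have hG₂ : G₂.card = hit.card :=
    Finset.card_image_of_injective _ fun S S' h => by simpa using (Prod.mk.inj h).2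
  have hdG : Disjoint G₁ G₂ := by
    rw [Finset.disjoint_left]
    intro a h1 h2
    obtain ⟨x, -, rfl⟩ := Finset.mem_image.1 h1
    obtain ⟨S, -, h⟩ := Finset.mem_image.1 h2
    exact hemb' _ _ (Prod.mk.inj h).2.symm
  refine ⟨G₁ ∪ G₂, ⟨?_, ?_⟩, ?_⟩
  · intro a ha
    rcases Finset.mem_union.1 ha with ha | ha
    · obtain ⟨x, hx, rfl⟩ := Finset.mem_image.1 ha
      have hx' : x ∉ J := Finset.mem_compl.1 hx
      cases hfx : f x with
      | inl y =>
        have hxy : x.1 = y.1 := by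
          by_contra hne
          exact hx' (Finset.mem_filter.2 ⟨Finset.mem_univ _, y, hfx, hne⟩)
        have := hfP x y hfx
        refine ⟨?_, ?_⟩
        · rw [show x = (x.1, x.2) from rfl, show y = (x.1, y.2) by rw [hxy], hP] at this
          simp [emb, augEdge, fullPattern, hxy, this]
        · simp [emb, isInterconnectionEdge, hxy]
      | inr u =>
        refine ⟨?_, ?_⟩
        · simpa [hfx, emb, augEdge] using hfB x u hfx
        · simp [emb, isInterconnectionEdge]
    · obtain ⟨S, hS, rfl⟩ := Finset.mem_image.1 ha
      exact ⟨(ht S hS).2, rfl⟩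
  · intro a ha b hb hab
    rcases Finset.mem_union.1 ha with ha | ha <;> rcases Finset.mem_union.1 hb with hb | hb <;>
      obtain ⟨x, hx, rfl⟩ := Finset.mem_image.1 ha <;>
      obtain ⟨y, hy, rfl⟩ := Finset.mem_image.1 hb
    · have hxy : x ≠ y := by rintro rfl; exact hab rfl
      exact ⟨hxy, fun h => hxy (hf (hemb h))⟩
    · exact ⟨fun h => Finset.mem_compl.1 hx ((show x = t y from h) ▸ (ht y hy).1), hemb' _ _⟩
    · exact ⟨fun h => Finset.mem_compl.1 hy ((show t x = y from h) ▸ (ht x hx).1), (hemb' _ _).symm⟩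
    · have hxy : x ≠ y := by rintro rfl; exact hab rfl
      exact ⟨fun h => hxy (hdisj _ _ _ (ht x hx).2 ((show t x = t y from h) ▸ (ht y hy).2)), by simpa using hxy⟩
  · have hI : J.card + hitᶜ.card ≤ numInterconnections P := by
      rw [← Finset.card_attach (s := J), ← Finset.card_image_of_injective J.attach
        (f := fun x => ((x.1, s x) : (Fin k × Fin n) × (Fin k × Fin n)))
        (fun x y h => Subtype.ext (Prod.mk.inj h).1),
        ← Finset.card_image_of_injective hitᶜ
        (f := fun S => ((e S, e' S) : (Fin k × Fin n) × (Fin k × Fin n)))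
        (fun S S' h => hdisj _ _ _ (he S) ((Prod.mk.inj h).1 ▸ he S')),
        ← Finset.card_union_of_disjoint]
      · refine Finset.card_le_card fun a ha => Finset.mem_filter.2 ⟨Finset.mem_univ _, ?_⟩
        rcases Finset.mem_union.1 ha with ha | ha
        · obtain ⟨x, -, rfl⟩ := Finset.mem_image.1 ha
          exact ⟨hs' x, hfP _ _ (hs x)⟩
        · obtain ⟨S, -, rfl⟩ := Finset.mem_image.1 ha
          exact ⟨hne S, hPe S⟩
      · rw [Finset.disjoint_left]
        intro a h1 h2
        obtain ⟨x, -, rfl⟩ := Finset.mem_image.1 h1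
        obtain ⟨S, hS, h⟩ := Finset.mem_image.1 h2
        refine Finset.mem_compl.1 hS (Finset.mem_filter.2 ⟨Finset.mem_univ _, e S, ?_, he S⟩)
        rw [(Prod.mk.inj h).1]
        exact x.2
    have hJle : J.card ≤ Fintype.card (Fin k × Fin n) := Finset.card_le_univ J
    have hhitle : hit.card ≤ Fintype.card (inaccessibleSCCs As B) := Finset.card_le_univ hit
    rw [Finset.card_union_of_disjoint hdG, hG₁, hG₂]
    rw [Finset.card_compl] at hI
    rw [← Nat.card_coe_set_eq, Nat.card_eq_fintype_card]
    omega

/-! ### Visiting the subsystems in rotation -/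

/-- A cyclic distribution: if `St` meets all subsystems equally often, except that it may have one
more element in the subsystem of `x₀`, then `St` can be enumerated starting from `x₀` such that
consecutive elements lie in distinct subsystems. -/
lemma exists_alternating_order {k : ℕ} {α : Type*} [DecidableEq α] (hk : 2 ≤ k)
    (St : Finset (Fin k × α)) (x₀ : Fin k × α) (hx₀ : x₀ ∈ St)
    (h1 : ∀ i j, i ≠ x₀.1 → (St.filter fun x => x.1 = i).card ≤ (St.filter fun x => x.1 = j).card)
    (h2 : ∀ j, (St.filter fun x => x.1 = x₀.1).card ≤ (St.filter fun x => x.1 = j).card + 1) :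
    ∃ (pos : Fin k × α → ℕ) (prev : Fin k × α → Fin k × α), Set.InjOn pos St ∧
      ∀ s ∈ St, s ≠ x₀ → prev s ∈ St ∧ (prev s).1 ≠ s.1 ∧ pos s = pos (prev s) + 1 := by
  classical
  have hrk : ∀ i, ∃ rk : Fin k × α → ℕ,
      (∀ x ∈ St, x.1 = i → rk x < (St.filter fun x => x.1 = i).card) ∧
      (∀ x ∈ St, x.1 = i → ∀ y ∈ St, y.1 = i → rk x = rk y → x = y) ∧
      (∀ m < (St.filter fun x => x.1 = i).card, ∃ x ∈ St, x.1 = i ∧ rk x = m) ∧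
      (x₀.1 = i → rk x₀ = 0) := by
    intro i
    obtain ⟨g, hg⟩ : ∃ g : (St.filter fun x => x.1 = i) ≃
        Finset.range (St.filter fun x => x.1 = i).card, ∀ a ∈ {a | a.1 = x₀}, (g a : ℕ) = 0 := by
      refine Set.MapsTo.exists_equiv_extend_of_card_eq (f := fun _ => 0) (by simp) ?_ ?_
      · intro a _
        have := Finset.card_pos.2 ⟨_, a.2⟩
        exact Finset.mem_coe.2 (Finset.mem_range.2 this)
      · intro a ha b hb _
        exact Subtype.ext (ha.trans hb.symm)
    have hmem : ∀ {x}, x ∈ St → x.1 = i → x ∈ St.filter fun x => x.1 = i := fun h h' =>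
      Finset.mem_filter.2 ⟨h, h'⟩
    refine ⟨fun x => if h : x ∈ St.filter fun x => x.1 = i then g ⟨x, h⟩ else 0, ?_, ?_, ?_, ?_⟩
    · intro x hx hxi
      simp only [dif_pos (hmem hx hxi)]
      exact Finset.mem_range.1 (g _).2
    · intro x hx hxi y hy hyi h
      simp only [dif_pos (hmem hx hxi), dif_pos (hmem hy hyi)] at h
      exact congrArg Subtype.val (g.injective (Subtype.ext h))
    · intro m hm
      have hs := (g.symm ⟨m, Finset.mem_range.2 hm⟩).2
      refine ⟨_, (Finset.mem_filter.1 hs).1, (Finset.mem_filter.1 hs).2, ?_⟩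
      simp only [dif_pos hs, Subtype.coe_eta, Equiv.apply_symm_apply]
    · intro hi
      simp only [dif_pos (hmem hx₀ hi)]
      exact hg _ rfl
  choose rk hlt hinj hsurj hzero using hrk
  have hk0 : 0 < k := by omega
  -- The order is lexicographic in round `rk` and subsystem index `e`, with the subsystem of `x₀`
  -- first in each round. The predecessor is in the same round, or in the last subsystem of the
  -- preceding round; the latter differs from the first since `2 ≤ k`.
  let e : Equiv.Perm (Fin k) := Equiv.swap x₀.1 ⟨0, hk0⟩
  have he0 : (e x₀.1 : ℕ) = 0 := by simp [e]
  have hpos : ∀ r o r' o' : ℕ, o < k → o' < k → r * k + o = r' * k + o' → r = r' ∧ o = o' := by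
    intro r o r' o' ho ho' h
    have hm := congrArg (· % k) h
    simp only [Nat.mul_add_mod_self_right, Nat.mod_eq_of_lt ho, Nat.mod_eq_of_lt ho'] at hm
    subst hm
    exact ⟨Nat.eq_of_mul_eq_mul_right hk0 (by omega), rfl⟩
  have hprev : ∀ s, ∃ t, s ∈ St → s ≠ x₀ → t ∈ St ∧ t.1 ≠ s.1 ∧
      rk s.1 s * k + (e s.1 : ℕ) = rk t.1 t * k + (e t.1 : ℕ) + 1 := by
    intro s
    by_cases hs : s ∈ St ∧ s ≠ x₀
    swap
    · exact ⟨s, fun h h' => absurd ⟨h, h'⟩ hs⟩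
    obtain ⟨hs, hs0⟩ := hs
    cases ho : (e s.1 : ℕ) with
    | zero =>
      have hsi : s.1 = x₀.1 := e.injective (Fin.ext (ho.trans he0.symm))
      cases hr : rk s.1 s with
      | zero =>
        refine absurd (hinj x₀.1 s hs hsi x₀ hx₀ rfl ?_) hs0
        rw [hzero _ rfl, ← hr, hsi]
      | succ r =>
        have hlt' := hlt _ s hs rfl
        rw [hr, hsi] at hlt'
        have hei : e (e.symm ⟨k - 1, by omega⟩) = ⟨k - 1, by omega⟩ := e.apply_symm_apply _
        obtain ⟨t, ht, hti, hrt⟩ := hsurj (e.symm ⟨k - 1, by omega⟩) r (by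
          have := h2 (e.symm ⟨k - 1, by omega⟩); omega)
        refine ⟨t, fun _ _ => ⟨ht, ?_, ?_⟩⟩
        · intro h
          rw [hti] at h
          rw [← h, hei] at ho
          simp at ho; omega
        · rw [hti, hrt, hei, Nat.succ_mul]
          simp only
          omega
    | succ o =>
      have hok : o < k := by have := (e s.1).2; omega
      have hsi : s.1 ≠ x₀.1 := fun h => by rw [h, he0] at ho; omega
      have hei : e (e.symm ⟨o, hok⟩) = ⟨o, hok⟩ := e.apply_symm_apply _
      obtain ⟨t, ht, hti, hrt⟩ := hsurj (e.symm ⟨o, hok⟩) (rk s.1 s)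
        ((hlt _ s hs rfl).trans_le (h1 _ _ hsi))
      refine ⟨t, fun _ _ => ⟨ht, ?_, ?_⟩⟩
      · intro h
        rw [hti] at h
        rw [← h, hei] at ho
        simp at ho
      · rw [hti, hrt, hei]; rfl
  choose prev hprev using hprev
  refine ⟨fun s => rk s.1 s * k + (e s.1 : ℕ), prev, ?_, hprev⟩
  intro s hs t ht hst
  obtain ⟨h3, h4⟩ := hpos _ _ _ _ (e s.1).2 (e t.1).2 hst
  have hst1 : s.1 = t.1 := e.injective (Fin.ext h4)
  exact hinj t.1 s hs hst1 t ht rfl (by rw [← h3, hst1])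

/-! ### Matchings of maximum weight -/

section Weight

variable {k n : ℕ} {As : Pattern (Fin n) (Fin n)} {B : Pattern (Fin k × Fin n) (Fin 1)}

/-- The weight of a right node: `3` minus the cost of the edges, other than interconnections,
which end there. -/
def nodeWeight : AugRight As B → ℕ
  | Sum.inl _ => 2
  | Sum.inr (Sum.inl _) => 3
  | Sum.inr (Sum.inr _) => 1

lemma nodeWeight_pos (r : AugRight As B) : 0 < nodeWeight r := by
  rcases r with r | r | r <;> simp [nodeWeight]

/-- A matching without interconnections of maximum weight. -/
def IsMaxWeightMatching (G : Finset ((Fin k × Fin n) × AugRight As B)) : Prop :=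
  IsMatching (nonInterconnectionEdge As B) G ∧
    ∀ G', IsMatching (nonInterconnectionEdge As B) G' →
      ∑ e ∈ G', nodeWeight e.2 ≤ ∑ e ∈ G, nodeWeight e.2

variable (As B) in
lemma exists_isMaxWeightMatching :
    ∃ G : Finset ((Fin k × Fin n) × AugRight As B), IsMaxWeightMatching G := by
  obtain ⟨G, hG, hmax⟩ := Set.exists_max_image
    {G : Finset ((Fin k × Fin n) × AugRight As B) | IsMatching (nonInterconnectionEdge As B) G}
    (fun G => ∑ e ∈ G, nodeWeight e.2) (Set.toFinite _) ⟨∅, by simp [IsMatching]⟩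
  exact ⟨G, hG, hmax⟩

lemma nonInterconnectionEdge_inl {x y : Fin k × Fin n} :
    nonInterconnectionEdge As B x (Sum.inl y) ↔ x.1 = y.1 ∧ As x.2 y.2 = true := by
  by_cases h : x.1 = y.1 <;>
    simp [nonInterconnectionEdge, augEdge, fullPattern, isInterconnectionEdge, h]

lemma cost_add_nodeWeight {e : (Fin k × Fin n) × AugRight As B}
    (h : isInterconnectionEdge As B e = false) : augCost As B e + nodeWeight e.2 = 3 := by
  obtain ⟨x, y | u | S⟩ := e
  · have : x.1 = y.1 := by simpa [isInterconnectionEdge] using h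
    simp [augCost, nodeWeight, this]
  · simp [augCost, nodeWeight]
  · simp [augCost, nodeWeight]

lemma cost_of_interconnection {e : (Fin k × Fin n) × AugRight As B}
    (h : isInterconnectionEdge As B e = true) : augCost As B e = 3 := by
  obtain ⟨x, y | u | S⟩ := e
  · have : x.1 ≠ y.1 := by simpa [isInterconnectionEdge] using h
    simp [augCost, this]
  · simp [isInterconnectionEdge] at h
  · simp [isInterconnectionEdge] at h

/-- Interconnections cost exactly 3, so for a fixed number of edges, minimizing the cost is
maximizing the weight of the remaining edges. -/
lemma sum_cost_add_sum_nodeWeight (M : Finset ((Fin k × Fin n) × AugRight As B)) :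
    ∑ e ∈ M, augCost As B e +
      ∑ e ∈ M.filter (fun e => isInterconnectionEdge As B e = false), nodeWeight e.2 =
        3 * M.card := by
  rw [Finset.sum_filter, ← Finset.sum_add_distrib, mul_comm, ← smul_eq_mul, ← Finset.sum_const]
  refine Finset.sum_congr rfl fun e _ => ?_
  by_cases h : isInterconnectionEdge As B e = false
  · rw [if_pos h, cost_add_nodeWeight h]
  · rw [if_neg h, cost_of_interconnection (by simpa using h), add_zero]

/-- Maximum weight matchings have maximum cardinality. -/
lemma IsMaxWeightMatching.card_le {G G' : Finset ((Fin k × Fin n) × AugRight As B)}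
    (hG : IsMaxWeightMatching G) (hG' : IsMatching (nonInterconnectionEdge As B) G') :
    G'.card ≤ G.card := by
  classical
  by_contra hlt
  obtain ⟨H, hH, -, hcard, -, hsub⟩ := hG.1.exists_augment G G' hG' (by omega)
  refine absurd (hG.2 H hH) (not_le.2 ?_)
  have hsum : ∀ M : Finset ((Fin k × Fin n) × AugRight As B),
      IsMatching (nonInterconnectionEdge As B) M →
      ∑ e ∈ M, nodeWeight e.2 = ∑ r ∈ M.image Prod.snd, nodeWeight r := fun M hM =>
    (Finset.sum_image (f := nodeWeight) fun e he f hf h => by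
      by_contra hne; exact (hM.2 e he f hf hne).2 h).symm
  rw [hsum G hG.1, hsum H hH]
  obtain ⟨r, hr, hr'⟩ := Finset.exists_of_ssubset (hsub.ssubset_of_ne fun h => by
    have := congrArg Finset.card h
    rw [hG.1.card_right, hH.card_right] at this; omega)
  exact Finset.sum_lt_sum_of_subset hsub hr hr' (nodeWeight_pos r) fun _ _ _ => Nat.zero_le _

/-- Maximum weight matchings use the input. -/
lemma IsMaxWeightMatching.exists_input {G : Finset ((Fin k × Fin n) × AugRight As B)}
    (hG : IsMaxWeightMatching G) (hB : ∃ x, B x 0 = true) :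
    ∃ x, (x, Sum.inr (Sum.inl 0)) ∈ G := by
  classical
  by_contra hcon
  push Not at hcon
  obtain ⟨x, hx⟩ := hB
  have hsub : G.filter (fun e => e.1 ≠ x) ⊆ G := Finset.filter_subset _ _
  -- Rerouting `x` to the unused input gains 3 and loses at most one edge, of weight at most 2.
  have hM := (hG.1.mono hsub fun e he => hG.1.1 e (hsub he)).insert
    (x := x) (y := Sum.inr (Sum.inl 0)) ⟨hx, rfl⟩ (fun e he => (Finset.mem_filter.1 he).2)
    (fun e he h => hcon e.1 (h ▸ hsub he))
  have h1 := hG.2 _ hM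
  rw [Finset.sum_insert (by simp),
    ← Finset.sum_filter_add_sum_filter_not G (fun e => e.1 ≠ x)] at h1
  have h2 : ∑ e ∈ G.filter (fun e => ¬ e.1 ≠ x), nodeWeight e.2 ≤ 2 := by
    have hw : ∀ e ∈ G.filter (fun e => ¬ e.1 ≠ x), nodeWeight e.2 ≤ 2 := by
      rintro ⟨z, y | u | S⟩ he
      · simp [nodeWeight]
      · rw [Subsingleton.elim u 0] at he
        exact absurd (Finset.mem_filter.1 he).1 (hcon z)
      · simp [nodeWeight]
    have hc : (G.filter (fun e => ¬ e.1 ≠ x)).card ≤ 1 := by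
      refine Finset.card_le_one.2 fun a ha b hb => ?_
      rw [Finset.mem_filter, not_not] at ha hb
      by_contra hne
      exact (hG.1.2 a ha.1 b hb.1 hne).1 (ha.2.trans hb.2.symm)
    calc _ ≤ (G.filter (fun e => ¬ e.1 ≠ x)).card • 2 := Finset.sum_le_card_nsmul _ _ _ hw
      _ ≤ 2 := by simp only [smul_eq_mul]; omega
  have h3 : nodeWeight (As := As) (B := B) (Sum.inr (Sum.inl 0)) = 3 := rfl
  simp only [h3] at h1
  omega

/-- The edges inside subsystem `i`, or from the input into it. -/
def subsystemEdges (G : Finset ((Fin k × Fin n) × AugRight As B)) (i : Fin k) :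
    Finset ((Fin k × Fin n) × AugRight As B) :=
  G.filter fun e => e.1.1 = i ∧ 2 ≤ nodeWeight e.2

/-- The edges inside subsystem `i`. -/
def stateEdges (G : Finset ((Fin k × Fin n) × AugRight As B)) (i : Fin k) :
    Finset ((Fin k × Fin n) × AugRight As B) :=
  G.filter fun e => e.1.1 = i ∧ nodeWeight e.2 = 2

/-- A maximum weight matching matches in each subsystem at least as many states as there are state
edges in any other subsystem. -/
lemma IsMaxWeightMatching.card_stateEdges_le {G : Finset ((Fin k × Fin n) × AugRight As B)}
    (hG : IsMaxWeightMatching G) (i j : Fin k) :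
    (stateEdges G j).card ≤ (subsystemEdges G i).card := by
  classical
  by_contra hlt
  set G₁ := subsystemEdges G i with hG₁
  have hG₁G : G₁ ⊆ G := Finset.filter_subset _ _
  have hstate : ∀ e ∈ stateEdges G j, ∃ y : Fin n, e.2 = Sum.inl (j, y) ∧ As e.1.2 y = true := by
    rintro ⟨x, y | u | S⟩ he
    · rw [stateEdges, Finset.mem_filter] at he
      have := nonInterconnectionEdge_inl.1 (hG.1.1 _ he.1)
      exact ⟨y.2, by rw [← he.2.1, this.1], this.2⟩
    · exact absurd (Finset.mem_filter.1 he).2.2 (by simp [nodeWeight])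
    · exact absurd (Finset.mem_filter.1 he).2.2 (by simp [nodeWeight])
  -- Since the subsystems are identical, the state edges of `j` can be copied into `i`. Augmenting
  -- the edges of `G` in `i` by these copies will give a matching of larger weight.
  let φ : (Fin k × Fin n) × AugRight As B → (Fin k × Fin n) × AugRight As B := fun e =>
    ((i, e.1.2), e.2.elim (fun y => Sum.inl (i, y.2)) fun r => Sum.inr r)
  have hφ : ∀ e ∈ stateEdges G j, ∀ f ∈ stateEdges G j, e ≠ f →
      (φ e).1 ≠ (φ f).1 ∧ (φ e).2 ≠ (φ f).2 := by
    intro e he f hf hef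
    have h1 := hG.1.2 e (Finset.mem_filter.1 he).1 f (Finset.mem_filter.1 hf).1 hef
    obtain ⟨y, hy, -⟩ := hstate e he
    obtain ⟨z, hz, -⟩ := hstate f hf
    have hej : e.1.1 = j := (Finset.mem_filter.1 he).2.1
    have hfj : f.1.1 = j := (Finset.mem_filter.1 hf).2.1
    refine ⟨fun h => h1.1 (Prod.ext (hej.trans hfj.symm) (Prod.mk.inj h).2), fun h => h1.2 ?_⟩
    simp only [φ, hy, hz, Sum.elim_inl, Sum.inl.injEq, Prod.mk.injEq, true_and] at h
    rw [hy, hz, h]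
  set H := (stateEdges G j).image φ with hH
  have hHmem : ∀ e ∈ H, ∃ p y : Fin n, e = ((i, p), Sum.inl (i, y)) ∧ As p y = true := by
    intro e he
    obtain ⟨f, hf, rfl⟩ := Finset.mem_image.1 he
    obtain ⟨y, hy, hy'⟩ := hstate f hf
    exact ⟨f.1.2, y, by simp [φ, hy], hy'⟩
  have hHm : IsMatching (nonInterconnectionEdge As B) H := by
    refine ⟨fun e he => ?_, fun e he f hf hef => ?_⟩
    · obtain ⟨p, y, rfl, hy⟩ := hHmem e he
      exact nonInterconnectionEdge_inl.2 ⟨rfl, hy⟩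
    · rw [hH] at he hf
      obtain ⟨e', he', rfl⟩ := Finset.mem_image.1 he
      obtain ⟨f', hf', rfl⟩ := Finset.mem_image.1 hf
      exact hφ e' he' f' hf' fun h => hef (congrArg φ h)
  have hHc : H.card = (stateEdges G j).card := Finset.card_image_of_injOn fun e he f hf h => by
    by_contra hne; exact (hφ e he f hf hne).1 (congrArg Prod.fst h)
  have hG₁m : IsMatching (nonInterconnectionEdge As B) G₁ :=
    hG.1.mono hG₁G fun e he => hG.1.1 e (hG₁G he)
  obtain ⟨G₂, hG₂, hsub, hcard, hl, hr⟩ := hG₁m.exists_augment G₁ H hHm (by omega)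
  have hG₂mem : ∀ e ∈ G₂, e.1.1 = i ∧ 2 ≤ nodeWeight e.2 := by
    intro e he
    rcases Finset.mem_union.1 (hsub he) with h | h
    · exact (Finset.mem_filter.1 h).2
    · obtain ⟨p, y, rfl, -⟩ := hHmem e h
      exact ⟨rfl, le_rfl⟩
  -- Only collisions on the left must be removed: a state of subsystem `i` is the right end only of
  -- edges of `G` that already lie in `G₁`. At most one edge is lost, at the newly covered left
  -- node; it ends in an SCC node and has weight 1, whereas the new right node has weight at least
  -- 2.
  set G₃ := (G \ G₁).filter fun e => e.1 ∉ G₂.image Prod.fst with hG₃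
  have hG₃G : ∀ e ∈ G₃, e ∈ G ∧ e ∉ G₁ := fun e he => Finset.mem_sdiff.1 (Finset.mem_filter.1 he).1
  have hdis : ∀ e ∈ G₂, ∀ f ∈ G₃, e.1 ≠ f.1 ∧ e.2 ≠ f.2 := by
    intro e he f hf
    obtain ⟨hfG, hfG₁⟩ := hG₃G f hf
    refine ⟨fun h => (Finset.mem_filter.1 hf).2 (h ▸ Finset.mem_image_of_mem _ he), ?_⟩
    rcases Finset.mem_union.1 (hsub he) with h | h
    · exact (hG.1.2 e (hG₁G h) f hfG fun h' => hfG₁ (h' ▸ h)).2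
    · obtain ⟨p, y, rfl, -⟩ := hHmem e h
      intro h'
      have hf' := hG.1.1 f hfG
      rw [← h', nonInterconnectionEdge_inl] at hf'
      exact hfG₁ (Finset.mem_filter.2 ⟨hfG, hf'.1, by rw [← h']; exact le_rfl⟩)
  have hm : IsMatching (nonInterconnectionEdge As B) (G₂ ∪ G₃) := by
    refine ⟨fun e he => ?_, fun e he f hf hef => ?_⟩
    · rcases Finset.mem_union.1 he with he | he
      · exact hG₂.1 e he
      · exact hG.1.1 e (hG₃G e he).1
    · rcases Finset.mem_union.1 he with he | he <;> rcases Finset.mem_union.1 hf with hf | hf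
      · exact hG₂.2 e he f hf hef
      · exact hdis e he f hf
      · exact ⟨(hdis f hf e he).1.symm, (hdis f hf e he).2.symm⟩
      · exact hG.1.2 e (hG₃G e he).1 f (hG₃G f hf).1 hef
  have hle := hG.2 _ hm
  rw [Finset.sum_union (Finset.disjoint_left.2 fun e he hf => (hdis e he e hf).1 rfl),
    ← Finset.sum_sdiff hG₁G,
    ← Finset.sum_filter_add_sum_filter_not (G \ G₁) (fun e => e.1 ∉ G₂.image Prod.fst)] at hle
  have hsum : ∀ M : Finset ((Fin k × Fin n) × AugRight As B),
      IsMatching (nonInterconnectionEdge As B) M →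
      ∑ e ∈ M, nodeWeight e.2 = ∑ r ∈ M.image Prod.snd, nodeWeight r := fun M hM =>
    (Finset.sum_image (f := nodeWeight) fun e he f hf h => by
      by_contra hne; exact (hM.2 e he f hf hne).2 h).symm
  have h1 : ∑ e ∈ G₁, nodeWeight e.2 + 2 ≤ ∑ e ∈ G₂, nodeWeight e.2 := by
    rw [hsum _ hG₁m, hsum _ hG₂, ← Finset.sum_sdiff hr, add_comm]
    refine Nat.add_le_add_right ?_ _
    have h2 : ((G₂.image Prod.snd) \ (G₁.image Prod.snd)).card = 1 := by
      rw [Finset.card_sdiff_of_subset hr, hG₂.card_right, hG₁m.card_right]; omega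
    calc 2 = ((G₂.image Prod.snd) \ (G₁.image Prod.snd)).card • 2 := by rw [h2]; rfl
      _ ≤ _ := Finset.card_nsmul_le_sum _ _ _ fun r hr => by
        obtain ⟨e, he, rfl⟩ := Finset.mem_image.1 (Finset.mem_sdiff.1 hr).1
        exact (hG₂mem e he).2
  have h3 : ∑ e ∈ (G \ G₁).filter (fun e => ¬ e.1 ∉ G₂.image Prod.fst), nodeWeight e.2 ≤ 1 := by
    have hmem : ∀ e ∈ (G \ G₁).filter (fun e => ¬ e.1 ∉ G₂.image Prod.fst),
        (e ∈ G ∧ e ∉ G₁) ∧ e.1 ∈ G₂.image Prod.fst := fun e he => by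
      simpa only [Finset.mem_filter, Finset.mem_sdiff, not_not] using he
    have hw : ∀ e ∈ (G \ G₁).filter (fun e => ¬ e.1 ∉ G₂.image Prod.fst),
        nodeWeight e.2 ≤ 1 := by
      intro e he
      obtain ⟨⟨h4, h5⟩, h6⟩ := hmem e he
      obtain ⟨f, hf, hfe⟩ := Finset.mem_image.1 h6
      by_contra hgt
      exact h5 (Finset.mem_filter.2 ⟨h4, hfe ▸ (hG₂mem f hf).1, by omega⟩)
    have hc : ((G \ G₁).filter (fun e => ¬ e.1 ∉ G₂.image Prod.fst)).card ≤ 1 := by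
      have h2 : ((G₂.image Prod.fst) \ (G₁.image Prod.fst)).card = 1 := by
        rw [Finset.card_sdiff_of_subset hl, hG₂.card_left, hG₁m.card_left]; omega
      refine le_of_le_of_eq ?_ h2
      refine Finset.card_le_card_of_injOn Prod.fst ?_ ?_
      · intro e he
        obtain ⟨⟨h4, h5⟩, h6⟩ := hmem e he
        refine Finset.mem_coe.2 (Finset.mem_sdiff.2 ⟨h6, fun h7 => ?_⟩)
        obtain ⟨f, hf, hfe⟩ := Finset.mem_image.1 h7
        exact (hG.1.2 e h4 f (hG₁G hf) fun h => h5 (h ▸ hf)).1 hfe.symm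
      · intro e he f hf h
        by_contra hne
        exact (hG.1.2 e (hmem e he).1.1 f (hmem f hf).1.1 hne).1 h
    calc _ ≤ ((G \ G₁).filter (fun e => ¬ e.1 ∉ G₂.image Prod.fst)).card • 1 :=
          Finset.sum_le_card_nsmul _ _ _ hw
      _ ≤ 1 := by simpa using hc
  rw [← hG₃] at hle
  omega

end Weight

/-! ### Accessibility in composite systems -/

lemma IsAccessible.tail {ι κ : Type*} {P : Pattern ι ι} {Q : Pattern ι κ} {x y : ι}
    (h : IsAccessible P Q y) (hxy : P x y = true) : IsAccessible P Q x := by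
  obtain ⟨u, hu⟩ := h
  refine ⟨u, hu.tail ?_⟩
  exact hxy

lemma IsAccessible.trans {ι κ : Type*} {P : Pattern ι ι} {Q : Pattern ι κ} {x y : ι}
    (h : IsAccessible P Q y) (hxy : Relation.ReflTransGen (fun y x => P x y = true) y x) :
    IsAccessible P Q x := by
  induction hxy with
  | refl => exact h
  | tail _ h ih => exact ih.tail h

lemma isAccessible_of_input {ι κ : Type*} {P : Pattern ι ι} {Q : Pattern ι κ} {x : ι} {u : κ}
    (h : Q x u = true) : IsAccessible P Q x := by
  refine ⟨u, Relation.ReflTransGen.single ?_⟩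
  exact h

lemma IsAccessible.mono {ι κ : Type*} {P P' : Pattern ι ι} {Q : Pattern ι κ} {x : ι}
    (h : IsAccessible P Q x) (hP : ∀ x y, P x y = true → P' x y = true) :
    IsAccessible P' Q x := by
  obtain ⟨u, hu⟩ := h
  refine ⟨u, Relation.ReflTransGen.mono (fun a b hab => ?_) _ _ hu⟩
  rcases a with a | a <;> rcases b with b | b
  · exact hP _ _ hab
  · exact hab.elim
  · exact hab
  · exact hab.elim

lemma IsComposite.isAccessible_of_reaches {k n : ℕ} {κ : Type*} {As : Pattern (Fin n) (Fin n)}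
    {Q : Pattern (Fin k × Fin n) κ} {P : Pattern (Fin k × Fin n) (Fin k × Fin n)}
    (hP : IsComposite As P) {i : Fin k} {p q : Fin n} (h : IsAccessible P Q (i, p))
    (hpq : Reaches (stateDigraph As) p q) : IsAccessible P Q (i, q) := by
  refine h.trans (Relation.ReflTransGen.lift (fun p => (i, p)) (fun a b hab => ?_) _ _ hpq)
  exact (hP i b a).trans hab

lemma IsComposite.isAccessible_of_isolated {k n : ℕ} {κ : Type*} {As : Pattern (Fin n) (Fin n)}
    {Q : Pattern (Fin k × Fin n) κ} {P : Pattern (Fin k × Fin n) (Fin k × Fin n)}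
    (hP : IsComposite As P) {x : Fin k × Fin n} (h : IsAccessible (isolatedPattern k As) Q x) :
    IsAccessible P Q x := by
  refine h.mono ?_
  rintro ⟨i, p⟩ ⟨j, q⟩ hxy
  by_cases hij : i = j
  · subst hij
    rw [hP]
    simpa [isolatedPattern] using hxy
  · simp [isolatedPattern, hij] at hxy

/-- Every vertex of a finite digraph is reached from a non-top linked strongly connected
component. -/
lemma exists_nonTopLinked {V : Type*} [Finite V] (G : Digraph V) (v : V) :
    ∃ T, IsSCC G T ∧ IsNonTopLinked G T ∧ ∀ t ∈ T, Reaches G t v := by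
  -- Among the vertices reaching `v`, take one that is reached by the fewest vertices; an edge
  -- entering its component would yield one reached by fewer.
  obtain ⟨w, hw, hmin⟩ := Set.exists_min_image {w | Reaches G w v}
    (fun w => {z | Reaches G z w}.ncard) (Set.toFinite _) ⟨v, Relation.ReflTransGen.refl⟩
  refine ⟨{z | Reaches G w z ∧ Reaches G z w}, ⟨w, rfl⟩, ?_, fun t ht => ht.2.trans hw⟩
  intro z hz t ht hzt
  have hzw : Reaches G z w := Relation.ReflTransGen.head hzt ht.2
  refine absurd (hmin z (hzw.trans hw)) (not_le.2 (Set.ncard_lt_ncard ?_ (Set.toFinite _)))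
  refine ⟨fun a ha => Relation.ReflTransGen.trans ha hzw, fun h => hz ⟨?_, hzw⟩⟩
  exact h (Relation.ReflTransGen.refl : Reaches G w w)

/-! ### Linking the paths of a matching -/

section Chain

variable {k n : ℕ} {As : Pattern (Fin n) (Fin n)} {B : Pattern (Fin k × Fin n) (Fin 1)}

/-- The state `x ≠ x₀` is not matched to a state by `G`. -/
def IsUnfed (G : Finset ((Fin k × Fin n) × AugRight As B)) (x₀ x : Fin k × Fin n) : Prop :=
  x ≠ x₀ ∧ ∀ y, (x, Sum.inl y) ∉ G

/-- `St` consists of the path starts, here including the state fed by the input. The count turns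
comparisons of state edges between subsystems into the balance condition needed for the rotation. -/
lemma card_unfed_add_card_stateEdges [DecidableEq (AugRight As B)]
    {G : Finset ((Fin k × Fin n) × AugRight As B)}
    (hG : IsMatching (nonInterconnectionEdge As B) G) (i : Fin k) (St : Finset (Fin k × Fin n))
    (hSt : ∀ x, x ∈ St ↔ ∀ y, (x, Sum.inl y) ∉ G) :
    (St.filter fun x => x.1 = i).card + (stateEdges G i).card = n := by
  have hsub : stateEdges G i ⊆ G := Finset.filter_subset _ _
  have hm := hG.mono hsub fun e he => hG.1 e (hsub he)
  rw [← hm.card_left, ← Finset.card_union_of_disjoint]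
  · have : (St.filter fun x => x.1 = i) ∪ (stateEdges G i).image Prod.fst =
        Finset.univ.image fun p : Fin n => (i, p) := by
      ext x
      constructor
      · intro hx
        have hxi : x.1 = i := by
          rcases Finset.mem_union.1 hx with hx | hx
          · exact (Finset.mem_filter.1 hx).2
          · obtain ⟨e, he, rfl⟩ := Finset.mem_image.1 hx
            exact (Finset.mem_filter.1 he).2.1
        exact Finset.mem_image.2 ⟨x.2, Finset.mem_univ _, by rw [← hxi]⟩
      · intro hx
        obtain ⟨p, -, rfl⟩ := Finset.mem_image.1 hx
        by_cases h : (i, p) ∈ St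
        · exact Finset.mem_union_left _ (Finset.mem_filter.2 ⟨h, rfl⟩)
        · rw [hSt] at h
          push Not at h
          obtain ⟨y, hy⟩ := h
          exact Finset.mem_union_right _ (Finset.mem_image.2
            ⟨_, Finset.mem_filter.2 ⟨hy, rfl, rfl⟩, rfl⟩)
    rw [this, Finset.card_image_of_injective _ fun p q h => (Prod.mk.inj h).2, Finset.card_univ,
      Fintype.card_fin]
  · rw [Finset.disjoint_left]
    intro x hx hx'
    obtain ⟨⟨z, y | u | S⟩, he, rfl⟩ := Finset.mem_image.1 hx'
    · exact (hSt _).1 (Finset.mem_filter.1 hx).1 y (hsub he)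
    · exact absurd (Finset.mem_filter.1 he).2.2 (by simp [nodeWeight])
    · exact absurd (Finset.mem_filter.1 he).2.2 (by simp [nodeWeight])

/-- The paths formed by a matching of maximum weight can be linked by interconnections to a single
path which starts at the input. -/
lemma IsMaxWeightMatching.exists_chain {G : Finset ((Fin k × Fin n) × AugRight As B)}
    (hG : IsMaxWeightMatching G) (hk : 2 ≤ k) {x₀ : Fin k × Fin n}
    (hx₀ : (x₀, Sum.inr (Sum.inl 0)) ∈ G) :
    ∃ f : Fin k × Fin n → Fin k × Fin n,
      (∀ x, IsUnfed G x₀ x → x.1 ≠ (f x).1 ∧ ∀ z, (z, Sum.inl (f x)) ∉ G) ∧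
      (∀ x y, IsUnfed G x₀ x → IsUnfed G x₀ y → f x = f y → x = y) ∧
      ∀ P, IsComposite As P → (∀ x, IsUnfed G x₀ x → P x (f x) = true) →
        ∀ x, (∀ y, (x, Sum.inl y) ∉ G) → IsAccessible P B x := by
  classical
  let C : Finset ((Fin k × Fin n) × (Fin k × Fin n)) :=
    Finset.univ.filter fun e => (e.1, Sum.inl e.2) ∈ G
  have hCmem : ∀ x y, (x, y) ∈ C ↔ (x, Sum.inl y) ∈ G := fun x y => by simp [C]
  have hC : IsMatching (fun x y : Fin k × Fin n => x.1 = y.1 ∧ As x.2 y.2 = true) C := by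
    refine ⟨fun e he => nonInterconnectionEdge_inl.1 (hG.1.1 _ ((hCmem _ _).1 he)),
      fun e he f hf hef => ?_⟩
    have := hG.1.2 _ ((hCmem _ _).1 he) _ ((hCmem _ _).1 hf) fun h => hef
      (Prod.ext (Prod.mk.inj h).1 (Sum.inl_injective (Prod.mk.inj h).2))
    exact ⟨this.1, fun h => this.2 (congrArg Sum.inl h)⟩
  obtain ⟨ω, -, hω⟩ := hC.exists_pathEnd C
  let St : Finset (Fin k × Fin n) := Finset.univ.filter fun x => ∀ y, (x, Sum.inl y) ∉ G
  have hSt : ∀ x, x ∈ St ↔ ∀ y, (x, Sum.inl y) ∉ G := fun x => by simp [St]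
  have hx₀St : x₀ ∈ St := (hSt _).2 fun y hy => (hG.1.2 _ hx₀ _ hy (by simp)).1 rfl
  have hinput : ∀ x u, (x, Sum.inr (Sum.inl u)) ∈ G → x = x₀ := fun x u hx => by
    rw [Subsingleton.elim u 0] at hx
    by_contra hne
    exact (hG.1.2 _ hx _ hx₀ fun h => hne (Prod.mk.inj h).1).2 rfl
  have hsub : ∀ i, subsystemEdges G i ⊆ insert (x₀, Sum.inr (Sum.inl 0)) (stateEdges G i) := by
    rintro i ⟨x, y | u | S⟩ he
    · exact Finset.mem_insert_of_mem (Finset.mem_filter.2 ⟨(Finset.mem_filter.1 he).1,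
        (Finset.mem_filter.1 he).2.1, rfl⟩)
    · rw [hinput x u (Finset.mem_filter.1 he).1, Subsingleton.elim u 0]
      exact Finset.mem_insert_self _ _
    · exact absurd (Finset.mem_filter.1 he).2.2 (by simp [nodeWeight])
  have hsub' : ∀ i, i ≠ x₀.1 → subsystemEdges G i ⊆ stateEdges G i := by
    intro i hi e he
    rcases Finset.mem_insert.1 (hsub i he) with rfl | h
    · exact absurd (Finset.mem_filter.1 he).2.1.symm hi
    · exact h
  have hcard := fun i => card_unfed_add_card_stateEdges hG.1 i St hSt
  obtain ⟨pos, prev, hpos, hprev⟩ := exists_alternating_order hk St x₀ hx₀St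
    (fun i j hi => by
      have h1 := hG.card_stateEdges_le i j
      have h2 := Finset.card_le_card (hsub' i hi)
      have h3 := hcard i
      have h4 := hcard j
      omega)
    (fun j => by
      have h1 := hG.card_stateEdges_le x₀.1 j
      have h2 := (Finset.card_le_card (hsub x₀.1)).trans (Finset.card_insert_le _ _)
      have h3 := hcard x₀.1
      have h4 := hcard j
      omega)
  have hunfed : ∀ x, IsUnfed G x₀ x → x ∈ St ∧ x ≠ x₀ := fun x hx => ⟨(hSt x).2 hx.2, hx.1⟩
  have hωSt : ∀ x ∈ St, (∀ e ∈ C, e.2 ≠ ω x) ∧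
      Relation.ReflTransGen (fun y x : Fin k × Fin n => x.1 = y.1 ∧ As x.2 y.2 = true) x (ω x) :=
    fun x hx => hω x fun e he h => (hSt x).1 hx e.2 ((hCmem _ _).1 (h ▸ he))
  have hfst : ∀ x ∈ St, (ω x).1 = x.1 := fun x hx => by
    have := (hωSt x hx).2
    generalize ω x = y at this
    induction this with
    | refl => rfl
    | tail _ h ih => exact h.1.trans ih
  -- Each path start is fed from the end of the path before it in the rotation. A path stays in one
  -- subsystem, so this is an interconnection, and path ends are not used as predecessors in `G`.
  -- Cycles of `G` are not reached in this way, so accessibility is claimed for path starts only.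
  refine ⟨fun x => ω (prev x), fun x hx => ?_, fun x y hx hy hxy => ?_, fun P hP hPf => ?_⟩
  · obtain ⟨h1, h2, -⟩ := hprev x (hunfed x hx).1 (hunfed x hx).2
    refine ⟨fun h => h2 (h.trans (hfst _ h1)).symm, fun z hz => ?_⟩
    exact (hωSt _ h1).1 _ ((hCmem z _).2 hz) rfl
  · obtain ⟨-, -, h3⟩ := hprev x (hunfed x hx).1 (hunfed x hx).2
    obtain ⟨-, -, h3'⟩ := hprev y (hunfed y hy).1 (hunfed y hy).2
    refine hpos (hunfed x hx).1 (hunfed y hy).1 ?_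
    rw [h3, h3', ω.injective hxy]
  · have key : ∀ m x, pos x = m → x ∈ St → IsAccessible P B x := by
      intro m
      induction m with
      | zero =>
        intro x hxm hx
        by_cases hx0 : x = x₀
        · subst hx0
          exact isAccessible_of_input (hG.1.1 _ hx₀).1
        · have := (hprev x hx hx0).2.2
          omega
      | succ m ih =>
        intro x hxm hx
        by_cases hx0 : x = x₀
        · subst hx0
          exact isAccessible_of_input (hG.1.1 _ hx₀).1
        · obtain ⟨h1, h2, h3⟩ := hprev x hx hx0
          refine IsAccessible.tail ((ih (prev x) (by omega) h1).trans ?_)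
            (hPf x ⟨hx0, (hSt x).1 hx⟩)
          refine Relation.ReflTransGen.mono ?_ _ _ (hωSt _ h1).2
          rintro ⟨i, p⟩ ⟨j, q⟩ ⟨hij, hpq⟩
          obtain rfl : j = i := hij
          exact (hP _ _ _).trans hpq
    exact fun x hx => key _ x rfl ((hSt x).2 hx)

end Chain

/-! ### Completion to perfect matchings and to controllable composites -/

section Upper

variable {k n : ℕ} {As : Pattern (Fin n) (Fin n)} {B : Pattern (Fin k × Fin n) (Fin 1)}

variable (As B) in
lemma min_card_augRight : min (Nat.card (Fin k × Fin n)) (Nat.card (AugRight As B)) =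
    Fintype.card (Fin k × Fin n) := by
  rw [Nat.card_sum, min_eq_left (Nat.le_add_right _ _), Nat.card_eq_fintype_card]

/-- A matching of maximum weight can be completed to a perfect matching by interconnections. -/
lemma IsMaxWeightMatching.exists_perfectMatching
    {G : Finset ((Fin k × Fin n) × AugRight As B)} (hG : IsMaxWeightMatching G) (hk : 2 ≤ k)
    (hB : ∃ x, B x 0 = true) : ∃ M, IsPerfectMatching (augEdge As B) M ∧
      ∑ e ∈ M, augCost As B e + ∑ e ∈ G, nodeWeight e.2 = 3 * Fintype.card (Fin k × Fin n) := by
  classical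
  obtain ⟨x₀, hx₀⟩ := hG.exists_input hB
  obtain ⟨f, hf, hinj, -⟩ := hG.exists_chain hk hx₀
  -- Only states that `G` leaves uncovered get a chain edge here; those matched to SCC nodes keep
  -- their edge.
  let N : Finset ((Fin k × Fin n) × AugRight As B) :=
    (G.image Prod.fst)ᶜ.image fun x => (x, Sum.inl (f x))
  have hN : ∀ e ∈ N, (∀ r, (e.1, r) ∉ G) ∧ IsUnfed G x₀ e.1 ∧ e.2 = Sum.inl (f e.1) := by
    intro e he
    obtain ⟨x, hx, rfl⟩ := Finset.mem_image.1 he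
    have hx' : ∀ r, (x, r) ∉ G := fun r hr =>
      Finset.mem_compl.1 hx (Finset.mem_image.2 ⟨_, hr, rfl⟩)
    exact ⟨hx', ⟨fun h => hx' _ (h ▸ hx₀), fun y => hx' _⟩, rfl⟩
  have hGN : ∀ e ∈ G, ∀ e' ∈ N, e.1 ≠ e'.1 ∧ e.2 ≠ e'.2 := by
    intro e he e' he'
    obtain ⟨h1, h2, h3⟩ := hN e' he'
    refine ⟨fun h => h1 e.2 (h ▸ he), fun h => (hf _ h2).2 e.1 ?_⟩
    rw [← h3, ← h]
    exact he
  have hinter : ∀ e ∈ N, isInterconnectionEdge As B e = true := by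
    intro e he
    obtain ⟨-, h2, h3⟩ := hN e he
    rw [show e = (e.1, e.2) from rfl, h3]
    simpa [isInterconnectionEdge] using (hf _ h2).1
  have hcard : (G ∪ N).card = Fintype.card (Fin k × Fin n) := by
    rw [Finset.card_union_of_disjoint (Finset.disjoint_left.2 fun e he he' =>
      (hGN e he e he').1 rfl), Finset.card_image_of_injective _ fun x y h => (Prod.mk.inj h).1,
      Finset.card_compl, hG.1.card_left]
    have := Finset.card_le_univ (G.image Prod.fst)
    rw [hG.1.card_left] at this
    omega
  refine ⟨G ∪ N, ⟨⟨fun e he => ?_, fun e he e' he' hne => ?_⟩, ?_⟩, ?_⟩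
  · rcases Finset.mem_union.1 he with he | he
    · exact (hG.1.1 e he).1
    · obtain ⟨-, h2, h3⟩ := hN e he
      rw [h3]
      simp [augEdge, fullPattern, (hf _ h2).1]
  · rcases Finset.mem_union.1 he with he | he <;> rcases Finset.mem_union.1 he' with he' | he'
    · exact hG.1.2 e he e' he' hne
    · exact hGN e he e' he'
    · exact ⟨(hGN e' he' e he).1.symm, (hGN e' he' e he).2.symm⟩
    · obtain ⟨-, h2, h3⟩ := hN e he
      obtain ⟨-, h2', h3'⟩ := hN e' he'
      have h1 : e.1 ≠ e'.1 := fun h => hne (Prod.ext h (by rw [h3, h3', h]))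
      refine ⟨h1, fun h => h1 (hinj _ _ h2 h2' ?_)⟩
      rw [h3, h3'] at h
      exact Sum.inl_injective h
  · rw [hcard, min_card_augRight]
  · have hfil : (G ∪ N).filter (fun e => isInterconnectionEdge As B e = false) = G := by
      ext e
      rw [Finset.mem_filter, Finset.mem_union]
      constructor
      · rintro ⟨he | he, h⟩
        · exact he
        · rw [hinter e he] at h; cases h
      · exact fun he => ⟨Or.inl he, (hG.1.1 e he).2⟩
    have := sum_cost_add_sum_nodeWeight (G ∪ N)
    rwa [hfil, hcard] at this

/-- From a matching of maximum weight one obtains a structurally controllable composite system. -/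
lemma IsMaxWeightMatching.exists_composite
    {G : Finset ((Fin k × Fin n) × AugRight As B)} (hG : IsMaxWeightMatching G) (hk : 2 ≤ k)
    (hB : ∃ x, B x 0 = true) : ∃ P ∈ controllableComposites As B,
      numInterconnections P + G.card ≤
        Fintype.card (Fin k × Fin n) + (inaccessibleSCCs As B).ncard := by
  classical
  have : Fintype (inaccessibleSCCs As B) := Fintype.ofFinite _
  obtain ⟨x₀, hx₀⟩ := hG.exists_input hB
  obtain ⟨f, hf, hinj, hchain⟩ := hG.exists_chain hk hx₀
  have : Nontrivial (Fin k) := Fin.nontrivial_iff_two_le.2 hk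
  obtain ⟨i₁, hi₁⟩ := exists_ne x₀.1
  obtain ⟨T₀, ⟨p₀, hT₀⟩, hT₀', -⟩ := exists_nonTopLinked (stateDigraph As) x₀.2
  have hp₀ : p₀ ∈ T₀ := by
    rw [hT₀]; exact ⟨Relation.ReflTransGen.refl, Relation.ReflTransGen.refl⟩
  choose e he using fun S : inaccessibleSCCs As B => inaccessibleSCCs_nonempty S.2
  -- The extra edges start at `x₀`, except into SCCs of its own subsystem, where a source elsewhere
  -- is required. This source lies in a non-top linked SCC of subsystem `i₁`, whose accessibility
  -- depends only on `x₀` and the chain, so the argument is not circular.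
  let src : inaccessibleSCCs As B → Fin k × Fin n := fun S =>
    if (e S).1 = x₀.1 then (i₁, p₀) else x₀
  have hsrc : ∀ S, (e S).1 ≠ (src S).1 := by
    intro S
    by_cases h : (e S).1 = x₀.1
    · simp only [src, if_pos h]; rw [h]; exact hi₁.symm
    · simpa only [src, if_neg h] using h
  let unhit : Finset (inaccessibleSCCs As B) :=
    Finset.univ.filter fun S => ∀ x ∈ S.1, ¬ IsUnfed G x₀ x
  let P : Pattern (Fin k × Fin n) (Fin k × Fin n) := Matrix.of fun x y =>
    if x.1 = y.1 then As x.2 y.2 else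
      decide ((IsUnfed G x₀ x ∧ y = f x) ∨ ∃ S ∈ unhit, x = e S ∧ y = src S)
  have hP : IsComposite As P := fun i p q => by simp [P]
  have hPf : ∀ x, IsUnfed G x₀ x → P x (f x) = true := fun x hx => by
    simp [P, (hf x hx).1, hx]
  have hPS : ∀ S ∈ unhit, P (e S) (src S) = true := fun S hS => by
    simp only [P, Matrix.of_apply, if_neg (hsrc S), decide_eq_true_eq]
    exact Or.inr ⟨S, hS, rfl, rfl⟩
  have hacc₀ := hchain P hP hPf
  have hx₀acc : IsAccessible P B x₀ := isAccessible_of_input (hG.1.1 _ hx₀).1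
  have hSCC : ∀ (i : Fin k) (T : Set (Fin n)), IsSCC (stateDigraph As) T →
      IsNonTopLinked (stateDigraph As) T →
      (i = x₀.1 → IsAccessible P B (i₁, p₀)) → ∀ p ∈ T, IsAccessible P B (i, p) := by
    intro i T hT hT' hi p hp
    suffices h : ∃ q ∈ T, IsAccessible P B (i, q) by
      obtain ⟨q, hq, hacc⟩ := h
      obtain ⟨v, rfl⟩ := hT
      exact hP.isAccessible_of_reaches hacc (hq.2.trans hp.1)
    by_cases hiso : ∃ q ∈ T, IsAccessible (isolatedPattern k As) B (i, q)
    · obtain ⟨q, hq, hacc⟩ := hiso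
      exact ⟨q, hq, hP.isAccessible_of_isolated hacc⟩
    push Not at hiso
    have hS : (fun p => (i, p)) '' T ∈ inaccessibleSCCs As B := by
      refine ⟨i, T, hT, hT', rfl, ?_⟩
      rintro _ ⟨q, hq, rfl⟩
      exact hiso q hq
    by_cases hhit : ∃ q ∈ T, IsUnfed G x₀ (i, q)
    · obtain ⟨q, hq, hq'⟩ := hhit
      exact ⟨q, hq, hacc₀ _ hq'.2⟩
    push Not at hhit
    have hun : (⟨_, hS⟩ : inaccessibleSCCs As B) ∈ unhit := by
      refine Finset.mem_filter.2 ⟨Finset.mem_univ _, ?_⟩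
      rintro _ ⟨q, hq, rfl⟩
      exact hhit q hq
    obtain ⟨q, hq, hqe⟩ := he ⟨_, hS⟩
    have hsacc : IsAccessible P B (src ⟨_, hS⟩) := by
      by_cases h : (e ⟨_, hS⟩).1 = x₀.1
      · simp only [src, if_pos h]
        exact hi (by rw [← h, ← hqe])
      · simp only [src, if_neg h]
        exact hx₀acc
    have := hsacc.tail (hPS _ hun)
    rw [← hqe] at this
    exact ⟨q, hq, this⟩
  have hi₁acc : IsAccessible P B (i₁, p₀) :=
    hSCC i₁ T₀ ⟨p₀, hT₀⟩ hT₀' (fun h => absurd h hi₁) p₀ hp₀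
  have hacc : ∀ x, IsAccessible P B x := by
    rintro ⟨i, p⟩
    obtain ⟨T, hT, hT', hTp⟩ := exists_nonTopLinked (stateDigraph As) p
    obtain ⟨v, hv⟩ := id hT
    have hvT : v ∈ T := by
      rw [hv]; exact ⟨Relation.ReflTransGen.refl, Relation.ReflTransGen.refl⟩
    exact hP.isAccessible_of_reaches (hSCC i T hT hT' (fun _ => hi₁acc) v hvT) (hTp v hvT)
  have hfed : ∀ x, ∃ y, ¬ IsUnfed G x₀ x → x ≠ x₀ → (x, Sum.inl y) ∈ G := by
    intro x
    by_cases h : ∃ y, (x, Sum.inl y) ∈ G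
    · obtain ⟨y, hy⟩ := h
      exact ⟨y, fun _ _ => hy⟩
    · push Not at h
      exact ⟨x, fun h1 h2 => absurd ⟨h2, h⟩ h1⟩
  choose g hg using hfed
  -- Predecessors: the chain for unfed states, the input for `x₀`, and the edges of `G` for the
  -- others.
  have hsc : IsStructurallyControllable P B := by
    refine isStructurallyControllable_of_injective hacc
      (fun x => if IsUnfed G x₀ x then some (f x) else if x = x₀ then none else some (g x))
      ?_ ?_ ?_
    · intro x y hxy
      by_cases hx : IsUnfed G x₀ x <;> by_cases hy : IsUnfed G x₀ y
      · simp only [if_pos hx, if_pos hy, Option.some.injEq] at hxy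
        exact hinj x y hx hy hxy
      · by_cases hy0 : y = x₀
        · simp [if_pos hx, hy0] at hxy
          simp [IsUnfed] at hxy
        · simp only [if_pos hx, if_neg hy, if_neg hy0, Option.some.injEq] at hxy
          exact absurd (hxy ▸ hg y hy hy0) ((hf x hx).2 y)
      · by_cases hx0 : x = x₀
        · simp [if_pos hy, hx0] at hxy
          simp [IsUnfed] at hxy
        · simp only [if_pos hy, if_neg hx, if_neg hx0, Option.some.injEq] at hxy
          exact absurd (hxy ▸ hg x hx hx0) ((hf y hy).2 x)
      · simp only [if_neg hx, if_neg hy] at hxy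
        by_cases hx0 : x = x₀ <;> by_cases hy0 : y = x₀
        · rw [hx0, hy0]
        · simp [if_pos hx0, if_neg hy0] at hxy
        · simp [if_neg hx0, if_pos hy0] at hxy
        · simp only [if_neg hx0, if_neg hy0, Option.some.injEq] at hxy
          by_contra hne
          refine (hG.1.2 _ (hg x hx hx0) _ (hg y hy hy0) fun h => hne (Prod.mk.inj h).1).2 ?_
          exact congrArg Sum.inl hxy
    · intro x y hxy
      by_cases hx : IsUnfed G x₀ x
      · simp only [if_pos hx, Option.some.injEq] at hxy
        exact hxy ▸ hPf x hx
      · by_cases hx0 : x = x₀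
        · simp only [if_neg hx, if_pos hx0] at hxy
          cases hxy
        · simp only [if_neg hx, if_neg hx0, Option.some.injEq] at hxy
          have h := nonInterconnectionEdge_inl.1 (hG.1.1 _ (hg x hx hx0))
          simp only [P, ← hxy, Matrix.of_apply, if_pos h.1]
          exact h.2
    · intro x hx
      by_cases hxu : IsUnfed G x₀ x
      · simp [if_pos hxu] at hx
      · by_cases hx0 : x = x₀
        · rw [hx0]; exact (hG.1.1 _ hx₀).1
        · simp [if_neg hxu, if_neg hx0] at hx
  refine ⟨P, ⟨hP, hsc⟩, ?_⟩
  let A : Finset (Fin k × Fin n) := Finset.univ.filter fun x => IsUnfed G x₀ x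
  have hI : numInterconnections P ≤ A.card + unhit.card := by
    refine (Finset.card_le_card (t := A.image (fun x => (x, f x)) ∪
      unhit.image fun S => (e S, src S)) ?_).trans ((Finset.card_union_le _ _).trans
        (Nat.add_le_add Finset.card_image_le Finset.card_image_le))
    rintro ⟨x, y⟩ hxy
    obtain ⟨h1, h2⟩ := (Finset.mem_filter.1 hxy).2
    simp only at h1
    simp only [P, Matrix.of_apply, if_neg h1, decide_eq_true_eq] at h2
    rcases h2 with ⟨h2, rfl⟩ | ⟨S, hS, rfl, rfl⟩
    · exact Finset.mem_union_left _ (Finset.mem_image.2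
        ⟨x, Finset.mem_filter.2 ⟨Finset.mem_univ _, h2⟩, rfl⟩)
    · exact Finset.mem_union_right _ (Finset.mem_image.2 ⟨S, hS, rfl⟩)
  -- Edges of weight at least 2 cover states that are not unfed. An SCC node used by `G` is matched
  -- to an unfed state, so its SCC needs no extra edge. Thus every edge of `G` saves one
  -- interconnection.
  have hfst : (G.filter fun e => 2 ≤ nodeWeight e.2).card ≤ Aᶜ.card := by
    refine Finset.card_le_card_of_injOn Prod.fst ?_ ?_
    · rintro ⟨x, y | u | S⟩ hx
      · refine Finset.mem_coe.2 (Finset.mem_compl.2 fun hA => ?_)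
        exact (Finset.mem_filter.1 hA).2.2 y (Finset.mem_filter.1 hx).1
      · refine Finset.mem_coe.2 (Finset.mem_compl.2 fun hA => ?_)
        have hxG := (Finset.mem_filter.1 hx).1
        rw [Subsingleton.elim u 0] at hxG
        exact (hG.1.2 _ hxG _ hx₀ fun h =>
          (Finset.mem_filter.1 hA).2.1 (Prod.mk.inj h).1).2 rfl
      · exact absurd (Finset.mem_filter.1 hx).2 (by simp [nodeWeight])
    · intro a ha b hb hab
      by_contra hne
      exact (hG.1.2 a (Finset.mem_filter.1 ha).1 b (Finset.mem_filter.1 hb).1 hne).1 hab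
  have hsnd : (G.filter fun e => ¬ 2 ≤ nodeWeight e.2).card ≤ unhitᶜ.card := by
    rw [← Finset.card_image_of_injective unhitᶜ
      (f := fun S => (Sum.inr (Sum.inr S) : AugRight As B)) fun S S' h => by simpa using h]
    refine Finset.card_le_card_of_injOn Prod.snd ?_ ?_
    · rintro ⟨x, y | u | S⟩ hx
      · exact absurd (Finset.mem_filter.1 hx).2 (by simp [nodeWeight])
      · exact absurd (Finset.mem_filter.1 hx).2 (by simp [nodeWeight])
      · have hxG := (Finset.mem_filter.1 hx).1
        refine Finset.mem_coe.2 (Finset.mem_image.2 ⟨S, Finset.mem_compl.2 fun hS => ?_, rfl⟩)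
        refine (Finset.mem_filter.1 hS).2 x (hG.1.1 _ hxG).1 ⟨?_, fun y hy => ?_⟩
        · rintro rfl
          exact (hG.1.2 _ hxG _ hx₀ (by simp)).1 rfl
        · exact (hG.1.2 _ hxG _ hy (by simp)).1 rfl
    · intro a ha b hb hab
      by_contra hne
      exact (hG.1.2 a (Finset.mem_filter.1 ha).1 b (Finset.mem_filter.1 hb).1 hne).2 hab
  have hsplit := Finset.card_filter_add_card_filter_not (s := G) (fun e => 2 ≤ nodeWeight e.2)
  have hA := Finset.card_le_univ A
  have hU := Finset.card_le_univ unhit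
  rw [Finset.card_compl] at hfst hsnd
  rw [← Nat.card_coe_set_eq, Nat.card_eq_fintype_card]
  omega

end Upper

/-! ### Counting and the theorem -/

/-- The interconnections and the entries of the diagonal blocks make up all entries. -/
lemma IsComposite.numStars_eq {k n : ℕ} {As : Pattern (Fin n) (Fin n)}
    {P : Pattern (Fin k × Fin n) (Fin k × Fin n)} (hP : IsComposite As P) :
    numStars P = numInterconnections P + numStars (isolatedPattern k As) := by
  unfold numStars numInterconnections
  rw [← Finset.card_filter_add_card_filter_not
    (s := Finset.univ.filter fun e : (Fin k × Fin n) × (Fin k × Fin n) => P e.1 e.2 = true)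
    (fun e => e.1.1 ≠ e.2.1), Finset.filter_filter, Finset.filter_filter]
  congr 2
  · ext e
    simp [and_comm]
  · ext ⟨⟨i, p⟩, ⟨j, q⟩⟩
    by_cases hij : i = j
    · subst hij
      simp [isolatedPattern, hP i p q]
    · simp [isolatedPattern, hij]

lemma card_filter_add_interconnectionEdgeCount {k n : ℕ} {As : Pattern (Fin n) (Fin n)}
    {B : Pattern (Fin k × Fin n) (Fin 1)} (M : Finset ((Fin k × Fin n) × AugRight As B)) :
    (M.filter fun e => isInterconnectionEdge As B e = false).card +
      interconnectionEdgeCount As B M = M.card := by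
  rw [interconnectionEdgeCount, add_comm,
    ← Finset.card_filter_add_card_filter_not (s := M)
      (fun e => isInterconnectionEdge As B e = true)]
  simp only [Bool.not_eq_true]

end StructuralControl

open StructuralControl in
theorem mainTheorem1 (k n : ℕ) (As : Pattern (Fin n) (Fin n))
    (B : Pattern (Fin k × Fin n) (Fin 1)) :
    (2 ≤ k → (∃ x, B x 0 = true) →
      (∃ P, IsOptimalComposite As B P) ∧
      (∃ M, IsMinCostPerfectMatching (augEdge As B) (augCost As B) M)) ∧
    (∀ P, IsOptimalComposite As B P →
      ∀ M, IsMinCostPerfectMatching (augEdge As B) (augCost As B) M →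
        numInterconnections P =
          interconnectionEdgeCount As B M + (inaccessibleSCCs As B).ncard) := by
  classical
  obtain ⟨G, hG⟩ := exists_isMaxWeightMatching As B
  refine ⟨fun hk hB => ⟨?_, ?_⟩, fun P hP M hM => ?_⟩
  · obtain ⟨P, hP, -⟩ := hG.exists_composite hk hB
    obtain ⟨P', hP', hmin⟩ := Set.exists_min_image (controllableComposites As B) numStars
      (Set.toFinite _) ⟨P, hP⟩
    exact ⟨P', hP', hmin⟩
  · obtain ⟨M, hM, -⟩ := hG.exists_perfectMatching hk hB
    obtain ⟨M', hM', hmin⟩ := Set.exists_min_image {M | IsPerfectMatching (augEdge As B) M}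
      (fun M => ∑ e ∈ M, augCost As B e) (Set.toFinite _) ⟨M, hM⟩
    exact ⟨M', hM', hmin⟩
  obtain ⟨G', hG', hlow⟩ := exists_matching_le_numInterconnections hP.1.1 hP.1.2
  have hG'card := Finset.card_le_univ (G'.image Prod.fst)
  rw [hG'.card_left] at hG'card
  by_cases htriv : k < 2 ∨ IsEmpty (Fin k × Fin n)
  -- Without two distinct subsystems, or without states, there are no interconnections at all, and
  -- the lower bound then forces `q = 0`.
  · have hsame : ∀ x y : Fin k × Fin n, x.1 = y.1 := by
      rcases htriv with hk | hX
      · intro x y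
        have := x.1.2
        have := y.1.2
        exact Fin.ext (by omega)
      · exact fun x => hX.elim x
    have h1 : numInterconnections P = 0 := by
      rw [numInterconnections, Finset.card_eq_zero, Finset.filter_eq_empty_iff]
      exact fun e _ h => h.1 (hsame _ _)
    have h2 : interconnectionEdgeCount As B M = 0 := by
      rw [interconnectionEdgeCount, Finset.card_eq_zero, Finset.filter_eq_empty_iff]
      rintro ⟨x, y | r⟩ -
      · simp [isInterconnectionEdge, hsame x y]
      · simp [isInterconnectionEdge]
    omega
  push Not at htriv
  obtain ⟨hk, ⟨x⟩⟩ := htriv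
  have hB : ∃ x, B x 0 = true := by
    obtain ⟨u, hu⟩ := hP.1.2.isAccessible x
    obtain h | ⟨c, h, -⟩ := Relation.ReflTransGen.cases_head hu
    · cases h
    · rcases c with c | c
      · exact ⟨c, by rw [Subsingleton.elim 0 u]; exact h⟩
      · exact h.elim
  obtain ⟨P', hP', hup⟩ := hG.exists_composite hk hB
  have hle := hP.2 P' hP'
  rw [hP.1.1.numStars_eq, hP'.1.numStars_eq] at hle
  obtain ⟨M', hM', hcost⟩ := hG.exists_perfectMatching hk hB
  have hMcost := hM.2 M' hM'
  have hMcard : M.card = Fintype.card (Fin k × Fin n) := by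
    rw [hM.1.2, min_card_augRight]
  have hsum := sum_cost_add_sum_nodeWeight M
  have hcount := card_filter_add_interconnectionEdgeCount M
  have hMF : IsMatching (nonInterconnectionEdge As B)
      (M.filter fun e => isInterconnectionEdge As B e = false) :=
    hM.1.1.mono (Finset.filter_subset _ _) fun e he =>
      ⟨hM.1.1.1 e (Finset.mem_filter.1 he).1, (Finset.mem_filter.1 he).2⟩
  -- The completion `M'` of `G` costs at least as much as `M`, so the part of `M` without
  -- interconnections weighs at least as much as `G`.
  have hMmax : IsMaxWeightMatching
      (M.filter fun e => isInterconnectionEdge As B e = false) :=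
    ⟨hMF, fun H hH => (hG.2 H hH).trans (by omega)⟩
  have h1 := hMmax.card_le hG'
  have h2 := hG.card_le hMF
  have h3 := hMmax.card_le hG.1
  omega
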